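/- **Setting.** Let $n,k,r$ be integers with $1\le k\le n$ and $1\le r<n$, let $M>0$, $\gamma\ge 0$ and $\rho\in[0,1]$. A file of size $M$ is stored on $n$ nodes, each of capacity $\alpha\ge 0$. The system goes through repair rounds. In each round an arbitrary set of $r$ nodes fails partially, and each faulty node keeps only data of size $\rho\alpha$. Each of the $n-r$ complete nodes then broadcasts a message of size $\beta=\gamma/(n-r)$, computed from its own content. Each faulty node computes its new content, of size at most $\alpha$, from its own surviving data and all the broadcast messages (functional repair; the maps used may depend on the present and past rounds but not on future ones). A code for $T$ rounds is required to let the file be recovered from the contents of any $k$ nodes after any sequence of at most $T$ rounds. Sizes are logarithms of cardinalities in a common unit $L>0$ that depends on the code (coding over blocks). The tuple $(n,k,\gamma,\alpha,r,\rho)$ is *feasible* (for file size $M$) if for every $T$ and every $M'<M$ there is a code for $T$ rounds and file size at least $M'$; here the way in which data is lost may even be chosen together with the code. It is *linearly feasible* if these codes can be chosen linear over a finite field $\mathbb F$, with file space $\mathbb F^{m}$, node contents in $\mathbb F^{a}$ and messages in $\mathbb F^{b}$, where $m\ge M'L$, $a\le\alpha L$ and $(n-r)b\le\gamma L$, such that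 a faulty node keeps $a_1\le\rho a$ of its $a$ symbols and recovery works whichever $a_1$ symbols survive. **Theorem 1.** There is a threshold $\alpha^*=\alpha^*(n,k,\gamma,r,\rho)\in[0,\infty]$ such that: 1. For every real $\alpha\ge 0$ with $\alpha\ge\alpha^*$, the tuple $(n,k,\gamma,\alpha,r,\rho)$ is feasible, and linear codes suffice: it is linearly feasible. If moreover $\alpha/M$, $\gamma/M$ and $\rho$ are rational, then for every $T$ there is such a linear code for file size exactly $M$ (that is, with $M'=M$). 2. For every $\alpha$ with $0\le\alpha<\alpha^*$, the tuple is not feasible, not even by nonlinear codes. 3. If $r$ divides $k$ and $k+r\le n$, then $$\alpha^*=\begin{cases}\dfrac{M}{k}, & \gamma\in[f(0),\infty),\\[2mm] \dfrac{M-g(i)\gamma}{k-ir(1-\rho)}, & \gamma\in[f(i),f(i-1)],\ i=1,\dots,\frac kr-1,\end{cases}$$ where $$f(i)=\frac{2M(1-\rho)(n-r)}{(2k-r(i+1)(1-\rho))\,i+\frac{2k}{r}(n-k)},\qquad g(i)=\frac{(2n-2k-r+ir)\,i}{2(n-r)}.$$ -/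

import Mathlib

/-! Distributed storage on `n` nodes with rounds of broadcast repair of `r` partially failed nodes. -/

/-- One repair round: the set of the `r` faulty nodes and, for each of them, which loss it suffered.
`Λ` is the type of possible losses of a single node. -/
structure RepairRound (n r : ℕ) (Λ : Type) where
  failed : Finset (Fin n)
  card_failed : failed.card = r
  loss : {i : Fin n // i ∈ failed} → Λ

/-- A code for the storage system: `W` is the set of files, `A` the set of possible contents of a
node, `S` the set of possible surviving data of a faulty node, `B` the set of messages that a
complete node can broadcast in one round. All the maps used in a round may depend on that
round and on the earlier ones (a list, latest first), but not on later ones. -/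
structure RepairCode (n r : ℕ) (W A S B Λ : Type) where
  /-- initial content of each node, as a function of the file -/
  encode : Fin n → W → A
  /-- message broadcast by a complete node, computed from its own content -/
  send : List (RepairRound n r Λ) → (e : RepairRound n r Λ) →
    {j : Fin n // j ∉ e.failed} → A → B
  /-- new content of a faulty node, computed from its own surviving data and from all the messages
  broadcast by the complete nodes -/
  repair : List (RepairRound n r Λ) → (e : RepairRound n r Λ) →
    {i : Fin n // i ∈ e.failed} → S → ({j : Fin n // j ∉ e.failed} → B) → A

namespace RepairCode

variable {n r : ℕ} {W A S B Λ : Type}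

/-- Content of node `i` after the given repair rounds (latest first) when the file is `w`;
`keep l x` is what is left of the content `x` of a node after the loss `l`. -/
def content (c : RepairCode n r W A S B Λ) (keep : Λ → A → S) (w : W) :
    List (RepairRound n r Λ) → Fin n → A
  | [], i => c.encode i w
  | e :: h, i =>
    if hi : i ∈ e.failed then
      c.repair h e ⟨i, hi⟩ (keep (e.loss ⟨i, hi⟩) (c.content keep w h i))
        (fun j => c.send h e j (c.content keep w h j.1))
    else c.content keep w h i

/-- After any sequence of at most `T` repair rounds, the file can be
reconstructed from the contents of any `k` nodes. -/
def Recovers (c : RepairCode n r W A S B Λ) (keep : Λ → A → S) (k T : ℕ) : Prop :=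
  ∀ h : List (RepairRound n r Λ), h.length ≤ T → ∀ K : Finset (Fin n), K.card = k →
    ∃ decode : ({i : Fin n // i ∈ K} → A) → W, ∀ w : W,
      decode (fun i => c.content keep w h i.1) = w

/-- All the encoding maps of the code are linear over `F`. -/
def IsLinear (F : Type) [Field F] [AddCommGroup W] [Module F W] [AddCommGroup A] [Module F A]
    [AddCommGroup S] [Module F S] [AddCommGroup B] [Module F B]
    (c : RepairCode n r W A S B Λ) : Prop :=
  (∀ i, IsLinearMap F (c.encode i)) ∧
  (∀ h e j, IsLinearMap F (c.send h e j)) ∧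
  (∀ h e i, IsLinearMap F
    (fun p : S × ({j : Fin n // j ∉ e.failed} → B) => c.repair h e i p.1 p.2))

end RepairCode

/-- There is a code, linear or not, that survives `T` repair rounds and stores a file of size `M`
with node capacity `α`, total repair bandwidth `γ` per round (that is, `γ / (n - r)` for each
complete node) and surviving data of size `ρ * α` in each faulty node. Sizes are
logarithms of cardinalities, measured in a common unit `L` (which covers the choice of the base of
the logarithm and coding over blocks). The loss mechanism is arbitrary: it may even be chosen
together with the code. -/
def CodeExists (n k r T : ℕ) (M α γ ρ : ℝ) : Prop :=
  ∃ (W A S B Λ : Type) (_ : Fintype W) (_ : Fintype A) (_ : Fintype S) (_ : Fintype B)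
    (_ : Nonempty Λ) (keep : Λ → A → S) (c : RepairCode n r W A S B Λ) (L : ℝ),
    0 < L ∧
    M * L ≤ Real.log (Fintype.card W) ∧
    Real.log (Fintype.card A) ≤ α * L ∧
    Real.log (Fintype.card S) ≤ ρ * α * L ∧
    ((n : ℝ) - (r : ℝ)) * Real.log (Fintype.card B) ≤ γ * L ∧
    c.Recovers keep k T

/-- There is a linear code over some finite field that survives `T` repair rounds and stores a file
of size `M` with node capacity `α` and repair bandwidth `γ`. Here the file is a vector
of `m` field symbols, a node stores `a` symbols, each complete node broadcasts `b` symbols, and each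
faulty node is left with `a₁ ≤ ρ * a` of its symbols, which can be any `a₁` of them (a loss is an
injection `Fin a₁ ↪ Fin a` that lists the surviving positions). A unit of size is `L` symbols. -/
def LinearCodeExists (n k r T : ℕ) (M α γ ρ : ℝ) : Prop :=
  ∃ (F : Type) (_ : Field F) (_ : Fintype F) (m a a₁ b : ℕ)
    (c : RepairCode n r (Fin m → F) (Fin a → F) (Fin a₁ → F) (Fin b → F) (Fin a₁ ↪ Fin a)) (L : ℝ),
    0 < L ∧
    M * L ≤ (m : ℝ) ∧
    (a : ℝ) ≤ α * L ∧
    (a₁ : ℝ) ≤ ρ * (a : ℝ) ∧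
    ((n : ℝ) - (r : ℝ)) * (b : ℝ) ≤ γ * L ∧
    c.IsLinear F ∧
    c.Recovers (fun l x => x ∘ l) k T

/-- Feasibility of `(n, k, γ, α, r, ρ)` for a file of size `M`: for any number of repair rounds, every
file size below `M` is supported by a code. -/
def Feasible (n k r : ℕ) (M α γ ρ : ℝ) : Prop :=
  ∀ T : ℕ, ∀ M' : ℝ, M' < M → CodeExists n k r T M' α γ ρ

/-- Feasibility by means of linear codes over finite fields. -/
def LinearlyFeasible (n k r : ℕ) (M α γ ρ : ℝ) : Prop :=
  ∀ T : ℕ, ∀ M' : ℝ, M' < M → LinearCodeExists n k r T M' α γ ρ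

/-- The breakpoints of the trade-off curve. -/
noncomputable def repairF (n k r : ℕ) (M ρ : ℝ) (i : ℕ) : ℝ :=
  2 * M * (1 - ρ) * ((n : ℝ) - r) /
    ((2 * (k : ℝ) - r * ((i : ℝ) + 1) * (1 - ρ)) * i + 2 * (k : ℝ) / r * ((n : ℝ) - k))

/-- The coefficient of `γ` on the pieces of the trade-off curve. -/
noncomputable def repairG (n k r : ℕ) (i : ℕ) : ℝ :=
  1 / 2 * (2 * (n : ℝ) - 2 * k - r + i * r) * i / ((n : ℝ) - r)

/-! The theorem is a max-flow/min-cut statement for the information flow graph unrolled over the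
rounds, followed by the computation of a minimal cut.

Tracing the demand of a decoder backwards through the rounds yields cuts. The data of a cut
determine the file, so its cost bounds the file size of any code (`CodeExists.le_cut`). Conversely,
if in each round all messages and new symbols are chosen generically over a large finite field, then
the rank of any demand is at least the smaller of the file dimension and the cost of some cut, so
linear codes attain the minimal cut (`RepairCode.exists_isLinear_recovers`). Hence, for `α ≥ 0`,
feasibility, linear feasibility and `CutBound` coincide. `CutBound` is a family of non-strict
inequalities, linear in `α` with nonnegative coefficients: the admissible `α` form a closed up-set,
and `α*` is its infimum.

For the formula, write `β = γ / (n - r)`. Letting `i` disjoint batches of `r` demanded nodes fail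
gives a cut (`IsCut.exists_batches`) of cost `(k - i r) α + i r ρ α + β (i (n - k) + r i (i - 1) /
2)`; equating it with `M` gives the stated value. No cut is cheaper, because a concave piecewise
linear potential `ψ` of the number of fully demanded nodes bounds all cuts from below
(`IsCut.potential_le`, `exists_potential`). The condition `f(i) ≤ γ ≤ f(i - 1)` places the initial
slope `(1 - ρ) α` of `ψ` where such a potential exists. -/

/-! ### Cuts of the information flow graph -/

/-- Cuts of the information flow graph of the storage system, read backwards in time. The list `h`
holds the sets of faulty nodes, latest first. What is demanded at the end is the full content of the
nodes in `F` and the surviving data of the nodes in `P`. The cut consists of `na` node contents, `ns`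
pieces of surviving data and `nb` broadcast messages, which together determine the demand. -/
inductive IsCut {n : ℕ} : List (Finset (Fin n)) → Finset (Fin n) → Finset (Fin n) →
    ℕ → ℕ → ℕ → Prop
  | nil (F P : Finset (Fin n)) : IsCut [] F P F.card P.card 0
  | pay (E : Finset (Fin n)) (h : List (Finset (Fin n))) (F P : Finset (Fin n)) (na ns nb : ℕ) :
      IsCut h (F \ E) (P \ E) na ns nb →
      IsCut (E :: h) F P (na + (F ∩ E).card) (ns + (P ∩ E).card) nb
  | replace (E : Finset (Fin n)) (h : List (Finset (Fin n))) (F P R C : Finset (Fin n))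
      (na ns nb : ℕ) : R ⊆ (F ∪ P) ∩ E → C ⊆ (F ∪ E)ᶜ →
      IsCut h ((F \ E) ∪ C) (((P \ E) \ C) ∪ R) na ns nb →
      IsCut (E :: h) F P (na + ((F ∩ E) \ R).card) (ns + ((P ∩ E) \ R).card)
        (nb + ((F ∪ E ∪ C)ᶜ).card)

namespace IsCut

variable {n : ℕ}

/-- A cut has a bounded number of elements. -/
theorem count_le {h : List (Finset (Fin n))} {F P : Finset (Fin n)} {na ns nb : ℕ}
    (c : IsCut h F P na ns nb) : na + ns + nb ≤ 3 * n * (h.length + 1) := by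
  have key : ∀ s : Finset (Fin n), s.card ≤ n := fun s => by
    simpa using s.card_le_univ
  induction c with
  | nil F P =>
    have := key F; have := key P
    simp only [List.length_nil]; omega
  | pay E h F P na ns nb _ ih =>
    have := key (F ∩ E); have := key (P ∩ E)
    simp only [List.length_cons]; nlinarith
  | replace E h F P R C na ns nb _ _ _ ih =>
    have := key ((F ∩ E) \ R); have := key ((P ∩ E) \ R); have := key ((F ∪ E ∪ C)ᶜ)
    simp only [List.length_cons]; nlinarith

/-- If `r` of the demanded nodes fail in each of `i` rounds, there is a cut in which all of them are
replaced by their surviving data and the messages of the nodes that are not demanded. -/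
theorem exists_batches {r : ℕ} (i : ℕ) : ∀ (F P : Finset (Fin n)), Disjoint F P →
    i * r ≤ F.card → ∃ (h : List (Finset (Fin n))) (nb : ℕ), (∀ E ∈ h, E.card = r) ∧
      IsCut h F P (F.card - i * r) (P.card + i * r) nb ∧
      (nb : ℝ) = i * (n - F.card) + r * (i * (i - 1)) / 2 := by
  induction i with
  | zero =>
    intro F P _ _
    exact ⟨[], 0, by simp, by simpa using IsCut.nil F P, by simp⟩
  | succ i ih =>
    intro F P hd hF
    have hF' : i * r + r ≤ F.card := by simpa [Nat.succ_mul] using hF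
    obtain ⟨E, hEF, hE⟩ := Finset.exists_subset_card_eq (show r ≤ F.card by omega)
    have hdE : Disjoint P E := (hd.mono_left hEF).symm
    have hc : (F \ E).card = F.card - r := by rw [Finset.card_sdiff_of_subset hEF, hE]
    have hcP : (P ∪ E).card = P.card + r := by rw [Finset.card_union_of_disjoint hdE, hE]
    obtain ⟨h, nb, hh, hcut, hnb⟩ := ih (F \ E) (P ∪ E)
      (Finset.disjoint_union_right.2 ⟨hd.mono_left Finset.sdiff_subset, Finset.sdiff_disjoint⟩)
      (by omega)
    have hFn : F.card ≤ n := by simpa using F.card_le_univ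
    -- The senders outside `F` are paid. One round earlier `F` has `r` nodes fewer, so `r` more
    -- messages are needed; this produces the term `r * (i * (i - 1)) / 2`.
    refine ⟨E :: h, nb + (n - F.card), ?_, ?_, ?_⟩
    · simpa [hE] using hh
    · have := IsCut.replace E h F P E ∅ (F.card - r - i * r) (P.card + r + i * r) nb
        (Finset.subset_inter (hEF.trans Finset.subset_union_left) le_rfl) (by simp)
        (by
          rw [hc, hcP] at hcut
          simpa [Finset.sdiff_eq_self_of_disjoint hdE] using hcut)
      convert this using 1
      · have : (F ∩ E) \ E = ∅ := by simp
        rw [this, Finset.card_empty, Nat.succ_mul]; omega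
      · have : (P ∩ E) \ E = ∅ := by simp
        rw [this, Finset.card_empty, Nat.succ_mul]; omega
      · rw [Finset.union_empty, Finset.union_eq_left.2 hEF, Finset.card_compl, Fintype.card_fin]
    · push_cast [Nat.cast_sub hFn]
      rw [hnb, hc, Nat.cast_sub (by omega : r ≤ F.card)]
      ring

/-- A lower bound for all cuts by a potential function of the number of fully demanded nodes. -/
theorem potential_le {r : ℕ} {ψ : ℕ → ℝ} {α σ β : ℝ} (hσα : σ ≤ α) (hσ : 0 ≤ σ)
    (h0 : ∀ x, ψ x ≤ (α - σ) * x)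
    (hstep : ∀ x y, ψ (x + y) ≤ ψ x + (α - σ) * y)
    (hbatch : ∀ x w : ℕ, x ≤ w + r → w + r ≤ n → ψ x ≤ ψ w + ((n : ℝ) - r - w) * β)
    {h : List (Finset (Fin n))} {F P : Finset (Fin n)} {na ns nb : ℕ}
    (c : IsCut h F P na ns nb) (hh : ∀ E ∈ h, E.card = r) (hd : Disjoint F P) :
    ψ F.card + σ * (F.card + P.card) ≤ na * α + ns * σ + nb * β := by
  induction c with
  | nil F P => have := h0 F.card; push_cast; nlinarith
  | pay E h F P na ns nb _ ih =>
    have ih := ih (fun E' hE' => hh E' (List.mem_cons_of_mem _ hE'))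
      (hd.mono Finset.sdiff_subset Finset.sdiff_subset)
    have h1 := hstep (F \ E).card (F ∩ E).card
    rw [Finset.card_sdiff_add_card_inter] at h1
    have h2 : ((F \ E).card : ℝ) + (F ∩ E).card = F.card := by
      exact_mod_cast Finset.card_sdiff_add_card_inter F E
    have h3 : ((P \ E).card : ℝ) + (P ∩ E).card = P.card := by
      exact_mod_cast Finset.card_sdiff_add_card_inter P E
    push_cast
    rw [← h2, ← h3]
    nlinarith
  | replace E h F P R C na ns nb hR hC _ ih =>
    have hE : E.card = r := hh E (by simp)
    have hCF : Disjoint (F \ E) C := by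
      rw [Finset.disjoint_left]; intro x hx hx'
      have := hC hx'; simp_all
    have ih := ih (fun E' hE' => hh E' (List.mem_cons_of_mem _ hE')) (by
      rw [Finset.disjoint_left]
      intro x hx hx'
      have hd' : x ∈ F → x ∉ P := fun hx => Finset.disjoint_left.1 hd hx
      have hR' := @hR x; have hC' := @hC x
      simp only [Finset.mem_union, Finset.mem_sdiff, Finset.mem_inter, Finset.mem_compl] at *
      tauto)
    have hw : ((F \ E) ∪ C).card = (F \ E).card + C.card := Finset.card_union_of_disjoint hCF
    have hcompl : ((F ∪ E ∪ C)ᶜ).card + ((F \ E) ∪ C).card + r = n := by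
      have h1 : F ∪ E ∪ C = ((F \ E) ∪ C) ∪ E := by
        ext x; simp only [Finset.mem_union, Finset.mem_sdiff]; tauto
      have h2 : Disjoint ((F \ E) ∪ C) E := by
        rw [Finset.disjoint_left]; intro x hx hx'
        have hC' := @hC x
        simp only [Finset.mem_union, Finset.mem_sdiff, Finset.mem_compl] at *
        tauto
      have h3 := Finset.card_compl_add_card (F ∪ E ∪ C)
      rw [Fintype.card_fin] at h3
      conv at h3 => enter [1, 2]; rw [h1, Finset.card_union_of_disjoint h2, hE]
      omega
    have hF : (F \ E).card + (F ∩ E).card = F.card := Finset.card_sdiff_add_card_inter F E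
    have hP : (P \ E).card + (P ∩ E).card = P.card := Finset.card_sdiff_add_card_inter P E
    have hFE : (F ∩ E).card ≤ r := hE ▸ Finset.card_le_card Finset.inter_subset_right
    -- Nodes of `P` may be promoted to `C`, so `P` can lose up to `C.card` nodes, but `F` gains that
    -- many. The total number of demanded nodes drops only by those paid for.
    have hP1 : (((P \ E) \ C) ∪ R).card + C.card ≥ (P \ E).card + R.card := by
      have h1 : Disjoint ((P \ E) \ C) R := by
        rw [Finset.disjoint_left]; intro x hx hx'
        have hR' := hR hx'
        simp only [Finset.mem_union, Finset.mem_sdiff, Finset.mem_inter] at *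
        tauto
      rw [Finset.card_union_of_disjoint h1]
      have := Finset.le_card_sdiff C (P \ E)
      omega
    have hRc : (F ∩ E).card + (P ∩ E).card ≤
        R.card + ((F ∩ E) \ R).card + ((P ∩ E) \ R).card := by
      have h1 := Finset.card_sdiff_add_card_inter (F ∩ E) R
      have h2 := Finset.card_sdiff_add_card_inter (P ∩ E) R
      have h3 : ((F ∩ E) ∩ R).card + ((P ∩ E) ∩ R).card ≤ R.card := by
        rw [← Finset.card_union_of_disjoint]
        · exact Finset.card_le_card (by intro x; simp; tauto)
        · exact hd.mono (fun x => by simp; tauto) (fun x => by simp; tauto)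
      omega
    -- At most `r` nodes leave `F`, and with `w` fully demanded nodes left exactly `n - r - w`
    -- messages are paid: this is the situation of `hbatch`.
    have hb := hbatch F.card ((F \ E) ∪ C).card (by omega) (by omega)
    have e1 : (F.card : ℝ) + P.card ≤ ((F \ E) ∪ C).card + (((P \ E) \ C) ∪ R).card +
        ((F ∩ E) \ R).card + ((P ∩ E) \ R).card := by
      norm_cast; omega
    have e2 : (((F ∪ E ∪ C)ᶜ).card : ℝ) = n - r - ((F \ E) ∪ C).card := by
      have : (((F ∪ E ∪ C)ᶜ).card : ℝ) + ((F \ E) ∪ C).card + r = n := by exact_mod_cast hcompl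
      linarith
    have e3 := mul_le_mul_of_nonneg_left e1 hσ
    have e4 : 0 ≤ (α - σ) * ((F ∩ E) \ R).card := mul_nonneg (by linarith) (Nat.cast_nonneg _)
    push_cast
    rw [e2]
    nlinarith

end IsCut

/-! ### The cut-set bound for arbitrary codes -/

namespace RepairCode

variable {n r : ℕ} {W A S B Λ : Type}

/-- If the side information `g`, the contents of the nodes in `F` and the surviving data of those in `P`
determine the file, then the number of files is bounded by the capacity of any cut. -/
theorem card_le_of_isCut [Fintype W] [Fintype A] [Fintype S] [Fintype B]
    (c : RepairCode n r W A S B Λ) (keep : Λ → A → S) (l₀ : Λ)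
    {hs : List (Finset (Fin n))} {F P : Finset (Fin n)} {na ns nb : ℕ}
    (cut : IsCut hs F P na ns nb) :
    ∀ (h : List (RepairRound n r Λ)), h.map RepairRound.failed = hs →
    (∀ e ∈ h, ∀ i, e.loss i = l₀) → ∀ (G : Type) [Fintype G] (g : W → G),
    (∀ w w', g w = g w' → (∀ i ∈ F, c.content keep w h i = c.content keep w' h i) →
      (∀ i ∈ P, keep l₀ (c.content keep w h i) = keep l₀ (c.content keep w' h i)) → w = w') →
    Fintype.card W ≤ Fintype.card G * Fintype.card A ^ na * Fintype.card S ^ ns *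
      Fintype.card B ^ nb := by
  classical
  induction cut with
  | nil F P =>
    intro h hh _ G _ g hg
    obtain rfl : h = [] := by simpa using hh
    have hinj : Function.Injective (fun w => ((g w, fun i : F => c.content keep w [] i),
        fun i : P => keep l₀ (c.content keep w [] i)) : W → (G × (F → A)) × (P → S)) := by
      intro w w' hw
      simp only [Prod.mk.injEq, funext_iff, Subtype.forall] at hw
      exact hg w w' hw.1.1 hw.1.2 hw.2
    have := Fintype.card_le_of_injective _ hinj
    simpa using this
  | pay E hs F P na ns nb _ ih =>
    intro h hh hl G _ g hg
    obtain ⟨e, h, rfl, rfl, hh'⟩ := List.map_eq_cons_iff.1 hh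
    -- What the cut pays in this round joins the side information, which is why `G` and `g` vary in
    -- the induction.
    have key := ih h hh' (fun e' he' => hl e' (by simp [he']))
      ((G × ((F ∩ e.failed : Finset _) → A)) × ((P ∩ e.failed : Finset _) → S))
      (fun w => ((g w, fun i => c.content keep w (e :: h) i),
        fun i => keep l₀ (c.content keep w (e :: h) i))) (by
      intro w w' hw h1 h2
      simp only [Prod.mk.injEq, funext_iff, Subtype.forall, Finset.mem_inter] at hw
      refine hg w w' hw.1.1 (fun i hi => ?_) (fun i hi => ?_)
      · by_cases hE : i ∈ e.failed
        · exact hw.1.2 i ⟨hi, hE⟩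
        · simpa [content, hE] using h1 i (by simp [hi, hE])
      · by_cases hE : i ∈ e.failed
        · exact hw.2 i ⟨hi, hE⟩
        · simpa [content, hE] using h2 i (by simp [hi, hE]))
    refine key.trans (le_of_eq ?_)
    simp only [Fintype.card_prod, Fintype.card_fun, Fintype.card_coe]
    ring
  | replace E hs F P R C na ns nb hR hC _ ih =>
    intro h hh hl G _ g hg
    obtain ⟨e, h, rfl, rfl, hh'⟩ := List.map_eq_cons_iff.1 hh
    have hcE : ∀ j : {j // j ∈ (F ∪ e.failed ∪ C)ᶜ}, j.1 ∉ e.failed := fun j hj => by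
      have := j.2; simp [hj] at this
    have key := ih h hh' (fun e' he' => hl e' (by simp [he']))
      (((G × (((F ∩ e.failed) \ R : Finset _) → A)) × (((P ∩ e.failed) \ R : Finset _) → S)) ×
        (((F ∪ e.failed ∪ C)ᶜ : Finset _) → B))
      (fun w => (((g w, fun i => c.content keep w (e :: h) i),
        fun i => keep l₀ (c.content keep w (e :: h) i)),
        fun j => c.send h e ⟨j.1, hcE j⟩ (c.content keep w h j.1))) (by
      intro w w' hw h1 h2
      simp only [Prod.mk.injEq, funext_iff, Subtype.forall] at hw
      obtain ⟨⟨⟨hw1, hw2⟩, hw3⟩, hw4⟩ := hw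
      have hmsg : (fun j : {j // j ∉ e.failed} => c.send h e j (c.content keep w h j.1)) =
          fun j => c.send h e j (c.content keep w' h j.1) := by
        funext ⟨j, hj⟩
        by_cases hF : j ∈ F
        · rw [h1 j (by simp [hF, hj])]
        by_cases hC' : j ∈ C
        · rw [h1 j (by simp [hC'])]
        exact hw4 j (by simp [hF, hj, hC'])
      have hrep : ∀ i ∈ R, c.content keep w (e :: h) i = c.content keep w' (e :: h) i := by
        intro i hi
        have hiE : i ∈ e.failed := (Finset.mem_inter.1 (hR hi)).2
        have := h2 i (by simp [hi])
        simp only [content, hiE, dite_true, hl e (by simp)]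
        rw [this, hmsg]
      refine hg w w' hw1 (fun i hi => ?_) (fun i hi => ?_)
      · by_cases hE : i ∈ e.failed
        · by_cases hiR : i ∈ R
          · exact hrep i hiR
          · exact hw2 i (by simp [hi, hE, hiR])
        · simpa [content, hE] using h1 i (by simp [hi, hE])
      · by_cases hE : i ∈ e.failed
        · by_cases hiR : i ∈ R
          · rw [hrep i hiR]
          · exact hw3 i (by simp [hi, hE, hiR])
        · by_cases hiC : i ∈ C
          · have := h1 i (by simp [hiC])
            simp [content, hE, this]
          · simpa [content, hE] using h2 i (by simp [hi, hE, hiC]))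
    refine key.trans (le_of_eq ?_)
    simp only [Fintype.card_prod, Fintype.card_fun, Fintype.card_coe]
    ring

end RepairCode

/-- The cut-set bound: the size of a file that survives `T` rounds is at most that of every cut. -/
theorem CodeExists.le_cut {n k r T : ℕ} {M α γ ρ : ℝ} (hrn : r < n) (hM : 0 < M)
    (hc : CodeExists n k r T M α γ ρ) {h : List (Finset (Fin n))} (hh : ∀ E ∈ h, E.card = r)
    (hT : h.length ≤ T) {K : Finset (Fin n)} (hK : K.card = k) {na ns nb : ℕ}
    (cut : IsCut h K ∅ na ns nb) :
    M ≤ na * α + ns * (ρ * α) + nb * (γ / ((n : ℝ) - r)) := by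
  obtain ⟨W, A, S, B, Λ, _, _, _, _, ⟨l₀⟩, keep, c, L, hL, hW, hA, hS, hB, hrec⟩ := hc
  have hex : ∀ h : List (Finset (Fin n)), (∀ E ∈ h, E.card = r) →
      ∃ H : List (RepairRound n r Λ), H.map RepairRound.failed = h ∧
        ∀ e ∈ H, ∀ i, e.loss i = l₀ := by
    intro h
    induction h with
    | nil => intro _; exact ⟨[], rfl, by simp⟩
    | cons E h ih =>
      intro hE
      obtain ⟨H, hH, hl⟩ := ih (fun E' hE' => hE E' (by simp [hE']))
      exact ⟨⟨E, hE E (by simp), fun _ => l₀⟩ :: H, by simp [hH], by simpa using hl⟩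
  obtain ⟨H, hH, hl⟩ := hex h hh
  obtain ⟨dec, hdec⟩ := hrec H (by rw [← hH] at hT; simpa using hT) K hK
  have hcard := c.card_le_of_isCut keep l₀ cut H hH hl Unit (fun _ => ()) (by
    intro w w' _ h1 _
    rw [← hdec w, ← hdec w']
    congr 1
    funext i
    exact h1 i.1 i.2)
  simp only [Fintype.card_unit, one_mul] at hcard
  -- Since `M > 0`, the type `W` is nonempty. Then no factor of the bound `hcard` vanishes, as the
  -- product rule for `Real.log` requires.
  have hWpos : 0 < Fintype.card W := by
    rcases Nat.eq_zero_or_pos (Fintype.card W) with h0 | h0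
    · rw [h0] at hW; simp at hW; nlinarith
    · exact h0
  have hne := (hWpos.trans_le hcard).ne'
  have hne' := hne
  simp only [mul_ne_zero_iff] at hne
  have hlog : Real.log (Fintype.card W) ≤ na * Real.log (Fintype.card A) +
      ns * Real.log (Fintype.card S) + nb * Real.log (Fintype.card B) := by
    have := Real.log_le_log (by exact_mod_cast hWpos) (show (Fintype.card W : ℝ) ≤
      (Fintype.card A : ℝ) ^ na * (Fintype.card S : ℝ) ^ ns * (Fintype.card B : ℝ) ^ nb by
        exact_mod_cast hcard)
    rw [Real.log_mul (mul_ne_zero (by exact_mod_cast hne.1.1) (by exact_mod_cast hne.1.2))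
      (by exact_mod_cast hne.2), Real.log_mul (by exact_mod_cast hne.1.1)
      (by exact_mod_cast hne.1.2), Real.log_pow, Real.log_pow, Real.log_pow] at this
    exact this
  have hpos : (0 : ℝ) < (n : ℝ) - r := sub_pos.2 (by exact_mod_cast hrn)
  have hB' : Real.log (Fintype.card B) ≤ γ / ((n : ℝ) - r) * L := by
    rw [div_mul_eq_mul_div, le_div_iff₀ hpos]; linarith
  have h1 := mul_le_mul_of_nonneg_left hA (Nat.cast_nonneg (α := ℝ) na)
  have h2 := mul_le_mul_of_nonneg_left hS (Nat.cast_nonneg (α := ℝ) ns)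
  have h3 := mul_le_mul_of_nonneg_left hB' (Nat.cast_nonneg (α := ℝ) nb)
  refine le_of_mul_le_mul_right ?_ hL
  nlinarith

/-! ### Generic position over a finite field -/

section GenericVectors

open Submodule Module

variable {F V : Type*} [Field F] [AddCommGroup V] [Module F V]

/-- A vector space over a finite field is not covered by few proper subspaces. -/
theorem Submodule.exists_mem_forall_notMem [Fintype F] {ι : Type*} (U : Submodule F V)
    (p : ι → Submodule F V) (s : Finset ι) (hs : s.card < Fintype.card F)
    (hp : ∀ i ∈ s, ¬ U ≤ p i) : ∃ x ∈ U, ∀ i ∈ s, x ∉ p i := by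
  classical
  induction s using Finset.induction_on with
  | empty => exact ⟨0, U.zero_mem, by simp⟩
  | insert j s hj ih =>
    rw [Finset.card_insert_of_notMem hj] at hs
    obtain ⟨x, hxU, hx⟩ := ih (by omega) (fun i hi => hp i (by simp [hi]))
    by_cases hxj : x ∈ p j
    swap
    · exact ⟨x, hxU, by simpa [hxj] using hx⟩
    obtain ⟨y, hyU, hyj⟩ := SetLike.not_le_iff_exists.1 (hp j (by simp))
    -- The line `y + t • x` misses `p j` entirely and meets every other `p i` at most once, so some
    -- `t` is left over.
    have huniq : ∀ i ∈ s, ∀ t t' : F, y + t • x ∈ p i → y + t' • x ∈ p i → t = t' := by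
      intro i hi t t' h h'
      by_contra hne
      have h2 : (t - t') • x ∈ p i := by
        have := (p i).sub_mem h h'
        rwa [add_sub_add_left_eq_sub, ← sub_smul] at this
      exact hx i hi (((p i).smul_mem_iff (sub_ne_zero.2 hne)).1 h2)
    -- The default `0` only forbids one value needlessly; the count of one forbidden value per `i`
    -- is kept.
    let f : ι → F := fun i => if h : ∃ t : F, y + t • x ∈ p i then h.choose else 0
    obtain ⟨t, ht⟩ : ∃ t, t ∉ s.image f := by
      by_contra! hall
      have h1 : s.image f = Finset.univ := Finset.eq_univ_iff_forall.2 hall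
      have h2 := Finset.card_image_le (s := s) (f := f)
      rw [h1, Finset.card_univ] at h2
      omega
    refine ⟨y + t • x, U.add_mem hyU (U.smul_mem t hxU), fun i hi hmem => ?_⟩
    rcases Finset.mem_insert.1 hi with rfl | hi
    · exact hyj (((p i).add_mem_iff_left ((p i).smul_mem t hxj)).1 hmem)
    · refine ht (Finset.mem_image.2 ⟨i, hi, ?_⟩)
      have h : ∃ t : F, y + t • x ∈ p i := ⟨t, hmem⟩
      have : f i = h.choose := dif_pos h
      rw [this]
      exact huniq i hi _ _ h.choose_spec hmem

/-- Over a large finite field, one can choose a vector in each subspace `U i` so generically that the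
rank of any of them over any subspace `S s` is as large as the subspaces `U i` allow. -/
theorem Submodule.exists_generic_vectors [Fintype F] [FiniteDimensional F V] {σ ι : Type*}
    [Fintype σ] [Fintype ι] [DecidableEq ι] (S : σ → Submodule F V) (U : ι → Submodule F V)
    (hq : Fintype.card σ * (2 ^ Fintype.card ι * 2 ^ Fintype.card ι) < Fintype.card F) :
    ∃ x : ι → V, (∀ i, x i ∈ U i) ∧ ∀ (s : σ) (D : Finset ι), ∃ D₂ ⊆ D,
      finrank F ↥(S s ⊔ D₂.sup U) + (D \ D₂).card ≤ finrank F ↥(S s ⊔ span F (x '' D)) := by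
  classical
  -- The extra set `E` of entire subspaces is what lets the induction move an index from `D` to
  -- `D₂`.
  suffices key : ∀ J : Finset ι, ∃ x : ι → V, (∀ i, x i ∈ U i) ∧
      ∀ (s : σ) (E D : Finset ι), D ⊆ J → ∃ D₂ ⊆ D,
        finrank F ↥((S s ⊔ E.sup U) ⊔ D₂.sup U) + (D \ D₂).card ≤
          finrank F ↥((S s ⊔ E.sup U) ⊔ span F (x '' D)) by
    obtain ⟨x, hx, h⟩ := key Finset.univ
    refine ⟨x, hx, fun s D => ?_⟩
    obtain ⟨D₂, hD₂, hle⟩ := h s ∅ D (Finset.subset_univ _)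
    rw [Finset.sup_empty, sup_bot_eq] at hle
    exact ⟨D₂, hD₂, hle⟩
  intro J
  induction J using Finset.induction_on with
  | empty =>
    refine ⟨0, fun i => (U i).zero_mem, fun s E D hD => ⟨∅, by simp, ?_⟩⟩
    obtain rfl := Finset.subset_empty.1 hD
    rw [Finset.sup_empty, Finset.coe_empty, Set.image_empty, span_empty]
    simp
  | insert j J hj ih =>
    obtain ⟨x, hx, h⟩ := ih
    let p : σ × Finset ι × Finset ι → Submodule F V := fun t =>
      (S t.1 ⊔ t.2.1.sup U) ⊔ span F (x '' t.2.2)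
    obtain ⟨y, hyU, hy⟩ := (U j).exists_mem_forall_notMem p
      (Finset.univ.filter fun t => ¬ U j ≤ p t) (by
        refine lt_of_le_of_lt (Finset.card_le_univ _) ?_
        simpa using hq) (by simp)
    have himg : ∀ D : Finset ι, j ∉ D → Function.update x j y '' D = x '' D := by
      intro D hD
      refine Set.image_congr fun i hi => Function.update_of_ne ?_ _ _
      rintro rfl; exact hD hi
    refine ⟨Function.update x j y, fun i => ?_, fun s E D hD => ?_⟩
    · by_cases hi : i = j
      · subst hi; simpa using hyU
      · simpa [hi] using hx i
    by_cases hjD : j ∈ D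
    swap
    · rw [himg D hjD]
      exact h s E D ((Finset.subset_insert_iff_of_notMem hjD).1 hD)
    have hD' : D.erase j ⊆ J := Finset.subset_insert_iff.1 hD
    have hspan : span F (Function.update x j y '' D) =
        span F {y} ⊔ span F (x '' (D.erase j : Finset ι)) := by
      have hD : (D : Set ι) = insert j ↑(D.erase j) := by
        rw [← Finset.coe_insert, Finset.insert_erase hjD]
      rw [hD, Set.image_insert_eq, span_insert, Function.update_self,
        himg _ (Finset.notMem_erase j D)]
    -- Either the other vectors already absorb `U j`, and `j` goes into `D₂`, or the generic `y`
    -- raises the rank by one, and `j` is counted in `D \ D₂`.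
    by_cases hU : U j ≤ p (s, E, D.erase j)
    · obtain ⟨D₂, hD₂, hle⟩ := h s (insert j E) (D.erase j) hD'
      have hjD₂ : j ∉ D₂ := fun hm => Finset.notMem_erase j D (hD₂ hm)
      refine ⟨insert j D₂, Finset.insert_subset hjD (hD₂.trans (Finset.erase_subset _ _)), ?_⟩
      have e1 : D \ insert j D₂ = D.erase j \ D₂ := by
        ext i; simp only [Finset.mem_sdiff, Finset.mem_insert, Finset.mem_erase]; tauto
      have e2 : (S s ⊔ E.sup U) ⊔ (insert j D₂).sup U =
          (S s ⊔ (insert j E).sup U) ⊔ D₂.sup U := by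
        simp only [Finset.sup_insert]; ac_rfl
      rw [e1, e2]
      refine hle.trans (finrank_mono ?_)
      rw [hspan, Finset.sup_insert]
      refine sup_le (sup_le (le_sup_left.trans le_sup_left) (sup_le (hU.trans ?_) ?_)) ?_
      · exact sup_le_sup_left le_sup_right _
      · exact le_sup_right.trans le_sup_left
      · exact le_sup_right.trans le_sup_right
    · obtain ⟨D₂, hD₂, hle⟩ := h s E (D.erase j) hD'
      have hjD₂ : j ∉ D₂ := fun hm => Finset.notMem_erase j D (hD₂ hm)
      refine ⟨D₂, hD₂.trans (Finset.erase_subset _ _), ?_⟩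
      have e1 : (D \ D₂).card = (D.erase j \ D₂).card + 1 := by
        rw [Finset.erase_sdiff_comm, Finset.card_erase_add_one]
        simp [hjD, hjD₂]
      have e2 : finrank F ↥(p (s, E, D.erase j)) <
          finrank F ↥((S s ⊔ E.sup U) ⊔ span F (Function.update x j y '' D)) := by
        refine finrank_lt_finrank_of_lt (lt_of_le_of_ne ?_ fun heq => ?_)
        · rw [hspan]; exact sup_le_sup_left le_sup_right _
        · refine hy (s, E, D.erase j) (by simpa using hU) ?_
          rw [heq, hspan]
          exact mem_sup_right (mem_sup_left (mem_span_singleton_self y))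
      rw [e1]
      change _ ≤ finrank F ↥(p (s, E, D.erase j)) at hle
      omega

end GenericVectors

/-! ### One generic repair round -/

section GenericRound

open Submodule Module

/-- The symbols of all the nodes in `X` and of the positions `pos i` in the nodes `i ∈ Y`. -/
def demandedSymbols {n a : ℕ} (X Y : Finset (Fin n)) (pos : Fin n → Finset (Fin a)) :
    Finset (Fin n × Fin a) :=
  Finset.univ.filter fun p => p.1 ∈ X ∨ p.1 ∈ Y ∧ p.2 ∈ pos p.1

theorem mem_demandedSymbols {n a : ℕ} {X Y : Finset (Fin n)} {pos : Fin n → Finset (Fin a)}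
    {p : Fin n × Fin a} :
    p ∈ demandedSymbols X Y pos ↔ p.1 ∈ X ∨ p.1 ∈ Y ∧ p.2 ∈ pos p.1 := by
  simp [demandedSymbols]

theorem card_demandedSymbols {n a a₁ : ℕ} {X Y : Finset (Fin n)} {pos : Fin n → Finset (Fin a)}
    (hd : Disjoint X Y) (hpos : ∀ i ∈ Y, (pos i).card = a₁) :
    (demandedSymbols X Y pos).card = a * X.card + a₁ * Y.card := by
  classical
  have key : ∀ i : Fin n, (∑ c : Fin a, if i ∈ X ∨ i ∈ Y ∧ c ∈ pos i then 1 else 0) =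
      (if i ∈ X then a else 0) + (if i ∈ Y then a₁ else 0) := by
    intro i
    by_cases hX : i ∈ X
    · have : i ∉ Y := Finset.disjoint_left.1 hd hX
      simp [hX, this]
    · by_cases hY : i ∈ Y
      · simp [hX, hY, hpos i hY]
      · simp [hX, hY]
  rw [demandedSymbols, Finset.card_filter, Fintype.sum_prod_type]
  simp only [key, Finset.sum_add_distrib]
  simp [Finset.sum_ite_mem, mul_comm]

variable {F V : Type*} [Field F] [AddCommGroup V] [Module F V]

/-- One round of repair with generic linear maps. The vectors `vec` of the stored symbols give rise to the
messages `μ` and to the new symbols `ν` of the nodes in `E`, and every demand on the new symbols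
can be traced back through the round as in the definition of `IsCut`. -/
theorem exists_generic_round [Fintype F] [FiniteDimensional F V] {n a a₁ : ℕ} (b : ℕ)
    (hq : 2 ^ (n * a) * (2 ^ (n * (a + b)) * 2 ^ (n * (a + b))) < Fintype.card F)
    (vec : Fin n × Fin a → V) (E : Finset (Fin n)) (surv : Fin n → Finset (Fin a))
    (hsurv : ∀ i ∈ E, (surv i).card = a₁) :
    ∃ (μ : Fin n × Fin b → V) (ν : Fin n × Fin a → V),
      (∀ p, μ p ∈ span F (vec '' {q | q.1 = p.1})) ∧
      (∀ p, ν p ∈ span F (vec '' {q | q.1 = p.1 ∧ q.2 ∈ surv p.1}) ⊔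
        span F (μ '' {q | q.1 ∉ E})) ∧
      ∀ (X Y : Finset (Fin n)) (pos : Fin n → Finset (Fin a)), Disjoint X Y →
        (∀ i ∈ Y, (pos i).card = a₁) →
        (finrank F (span F (vec '' demandedSymbols (X \ E) (Y \ E) pos)) +
            (a * (X ∩ E).card + a₁ * (Y ∩ E).card) ≤
          finrank F (span F ((fun p => if p.1 ∈ E then ν p else vec p) ''
            demandedSymbols X Y pos))) ∨
        ∃ (R C : Finset (Fin n)) (pos₁ : Fin n → Finset (Fin a)),
          R ⊆ (X ∪ Y) ∩ E ∧ C ⊆ (X ∪ E)ᶜ ∧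
          (∀ i ∈ ((Y \ E) \ C) ∪ R, (pos₁ i).card = a₁) ∧
          finrank F (span F (vec '' demandedSymbols ((X \ E) ∪ C) (((Y \ E) \ C) ∪ R) pos₁)) +
              (a * ((X ∩ E) \ R).card + a₁ * ((Y ∩ E) \ R).card) + b * ((X ∪ E ∪ C)ᶜ).card ≤
            finrank F (span F ((fun p => if p.1 ∈ E then ν p else vec p) ''
              demandedSymbols X Y pos)) := by
  classical
  have hmono : ∀ d ≤ a + b, 2 ^ (n * a) * (2 ^ (n * d) * 2 ^ (n * d)) < Fintype.card F := by
    intro d hd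
    refine lt_of_le_of_lt ?_ hq
    have : 2 ^ (n * d) ≤ 2 ^ (n * (a + b)) :=
      Nat.pow_le_pow_right (by norm_num) (Nat.mul_le_mul_left n hd)
    gcongr
  obtain ⟨μ, hμ, hμgen⟩ := Submodule.exists_generic_vectors
    (fun Q : Finset (Fin n × Fin a) => span F (vec '' Q))
    (fun p : Fin n × Fin b => span F (vec '' {q | q.1 = p.1}))
    (by simpa using hmono b (by omega))
  obtain ⟨ν, hν, hνgen⟩ := Submodule.exists_generic_vectors
    (fun Q : Finset (Fin n × Fin a) => span F (vec '' Q))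
    (fun p : Fin n × Fin a => span F (vec '' {q | q.1 = p.1 ∧ q.2 ∈ surv p.1}) ⊔
      span F (μ '' {q | q.1 ∉ E}))
    (by simpa using hmono a (by omega))
  refine ⟨μ, ν, hμ, hν, fun X Y pos hd hpos => ?_⟩
  set D : Finset (Fin n × Fin a) := (demandedSymbols X Y pos).filter fun p => p.1 ∈ E with hD
  set Q₀ := demandedSymbols (X \ E) (Y \ E) pos with hQ₀
  have hnew : span F (vec '' Q₀) ⊔ span F (ν '' D) ≤
      span F ((fun p => if p.1 ∈ E then ν p else vec p) '' demandedSymbols X Y pos) := by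
    rw [← span_union]
    refine span_mono (Set.union_subset ?_ ?_)
    · rintro _ ⟨p, hp, rfl⟩
      have hp' := mem_demandedSymbols.1 (Finset.mem_coe.1 hp)
      simp only [Finset.mem_sdiff] at hp'
      have hpE : p.1 ∉ E := by tauto
      refine ⟨p, Finset.mem_coe.2 (mem_demandedSymbols.2 (by tauto)), by simp [hpE]⟩
    · rintro _ ⟨p, hp, rfl⟩
      have hp' := Finset.mem_filter.1 (Finset.mem_coe.1 hp)
      exact ⟨p, hp'.1, by simp [hp'.2]⟩
  obtain ⟨D₂, hD₂, hle⟩ := hνgen Q₀ D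
  -- One symbol in `D₂` puts the whole node into `R`. Only nodes with no symbol in `D₂` are counted
  -- as paid, which keeps the rank estimate valid.
  set R : Finset (Fin n) := D₂.image Prod.fst with hR
  have hRsub : R ⊆ (X ∪ Y) ∩ E := by
    intro i hi
    obtain ⟨p, hp, rfl⟩ := Finset.mem_image.1 hi
    have h1 := Finset.mem_filter.1 (hD₂ hp)
    have h2 := mem_demandedSymbols.1 h1.1
    simp only [Finset.mem_inter, Finset.mem_union]
    exact ⟨by tauto, h1.2⟩
  have hcard : a * ((X ∩ E) \ R).card + a₁ * ((Y ∩ E) \ R).card ≤ (D \ D₂).card := by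
    rw [← card_demandedSymbols (pos := pos) (a₁ := a₁)
      (hd.mono (fun x => by simp; tauto) (fun x => by simp; tauto))
      (fun i hi => hpos i (by simp at hi; tauto))]
    refine Finset.card_le_card fun p hp => ?_
    have hp' := mem_demandedSymbols.1 hp
    simp only [Finset.mem_sdiff, Finset.mem_inter] at hp'
    rw [Finset.mem_sdiff, hD, Finset.mem_filter, mem_demandedSymbols]
    have hpR : p ∈ D₂ → p.1 ∈ R := fun h => Finset.mem_image_of_mem _ h
    tauto
  -- An empty `D₂` is the `IsCut.pay` case. Otherwise any single symbol of `D₂` brings in the span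
  -- of all messages, as in `IsCut.replace`.
  rcases D₂.eq_empty_or_nonempty with hemp | ⟨p₀, hp₀⟩
  · left
    have hR0 : R = ∅ := by rw [hR, hemp, Finset.image_empty]
    rw [hR0, Finset.sdiff_empty, Finset.sdiff_empty] at hcard
    rw [hemp, Finset.sup_empty, sup_bot_eq] at hle
    have := finrank_mono hnew
    rw [← hemp] at hle
    omega
  right
  set Q₁ : Finset (Fin n × Fin a) := Q₀ ∪ Finset.univ.filter (fun q => q.1 ∈ R ∧ q.2 ∈ surv q.1)
    with hQ₁
  -- Messages of nodes in `X \ E` are left out: they already lie in the span of `vec '' Q₀`.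
  set D' : Finset (Fin n × Fin b) := Finset.univ.filter (fun q => q.1 ∉ E ∧ q.1 ∉ X) with hD'
  obtain ⟨D₃, hD₃, hle'⟩ := hμgen Q₁ D'
  set C : Finset (Fin n) := D₃.image Prod.fst with hC
  have hCsub : C ⊆ (X ∪ E)ᶜ := by
    intro i hi
    obtain ⟨p, hp, rfl⟩ := Finset.mem_image.1 hi
    have h1 := (Finset.mem_filter.1 (hD₃ hp)).2
    simp only [Finset.mem_compl, Finset.mem_union]
    tauto
  have hcard' : b * ((X ∪ E ∪ C)ᶜ).card ≤ (D' \ D₃).card := by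
    have h0 := card_demandedSymbols (X := (X ∪ E ∪ C)ᶜ) (Y := ∅) (a₁ := 0)
      (pos := fun _ => (∅ : Finset (Fin b))) (by simp) (by simp)
    simp only [Finset.card_empty, mul_zero, add_zero] at h0
    rw [← h0]
    refine Finset.card_le_card fun p hp => ?_
    have hp' := mem_demandedSymbols.1 hp
    simp only [Finset.mem_compl, Finset.mem_union, Finset.notMem_empty, false_and, or_false]
      at hp'
    rw [Finset.mem_sdiff, hD', Finset.mem_filter]
    have hpC : p ∈ D₃ → p.1 ∈ C := fun h => Finset.mem_image_of_mem _ h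
    have := Finset.mem_univ p
    tauto
  let pos₁ : Fin n → Finset (Fin a) := fun i => if i ∈ E then surv i else pos i
  refine ⟨R, C, pos₁, hRsub, hCsub, fun i hi => ?_, ?_⟩
  · by_cases hiE : i ∈ E
    · simpa [pos₁, hiE] using hsurv i hiE
    · have hiR : i ∉ R := fun h => hiE (Finset.mem_inter.1 (hRsub h)).2
      simp only [pos₁, hiE, if_false]
      simp only [Finset.mem_union, Finset.mem_sdiff] at hi
      exact hpos i (by tauto)
  have hup : span F (vec '' Q₁) ⊔ span F (μ '' D') ≤ span F (vec '' Q₀) ⊔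
      D₂.sup (fun p : Fin n × Fin a => span F (vec '' {q | q.1 = p.1 ∧ q.2 ∈ surv p.1}) ⊔
        span F (μ '' {q | q.1 ∉ E})) := by
    refine sup_le ?_ ?_
    · rw [span_le]
      rintro _ ⟨q, hq, rfl⟩
      rcases Finset.mem_union.1 (Finset.mem_coe.1 hq) with hq | hq
      · exact mem_sup_left (subset_span ⟨q, hq, rfl⟩)
      · obtain ⟨hqR, hqs⟩ := (Finset.mem_filter.1 hq).2
        obtain ⟨p, hp, hpq⟩ := Finset.mem_image.1 hqR
        refine mem_sup_right (Finset.le_sup (f := fun p : Fin n × Fin a =>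
          span F (vec '' {q | q.1 = p.1 ∧ q.2 ∈ surv p.1}) ⊔ span F (μ '' {q | q.1 ∉ E})) hp ?_)
        exact mem_sup_left (subset_span ⟨q, ⟨hpq.symm, hpq ▸ hqs⟩, rfl⟩)
    · refine le_trans ?_ (le_trans (Finset.le_sup (f := fun p : Fin n × Fin a =>
        span F (vec '' {q | q.1 = p.1 ∧ q.2 ∈ surv p.1}) ⊔ span F (μ '' {q | q.1 ∉ E})) hp₀)
        le_sup_right)
      refine le_trans (span_mono (Set.image_mono fun q hq => ?_)) le_sup_right
      exact (Finset.mem_filter.1 (Finset.mem_coe.1 hq)).2.1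
  have hlow : span F (vec '' demandedSymbols ((X \ E) ∪ C) (((Y \ E) \ C) ∪ R) pos₁) ≤
      span F (vec '' Q₁) ⊔
        D₃.sup (fun p : Fin n × Fin b => span F (vec '' {q | q.1 = p.1})) := by
    rw [span_le]
    rintro _ ⟨q, hq, rfl⟩
    have hq' := mem_demandedSymbols.1 (Finset.mem_coe.1 hq)
    by_cases hqC : q.1 ∈ C
    · obtain ⟨p, hp, hpq⟩ := Finset.mem_image.1 hqC
      exact mem_sup_right (Finset.le_sup (f := fun p : Fin n × Fin b =>
        span F (vec '' {q | q.1 = p.1})) hp (subset_span ⟨q, hpq.symm, rfl⟩))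
    · refine mem_sup_left (subset_span ⟨q, Finset.mem_coe.2 (Finset.mem_union.2 ?_), rfl⟩)
      rw [hQ₀, mem_demandedSymbols, Finset.mem_filter]
      have hRE : q.1 ∈ R → q.1 ∈ E := fun h => (Finset.mem_inter.1 (hRsub h)).2
      have hu := Finset.mem_univ q
      by_cases hqE : q.1 ∈ E
      · simp only [pos₁, hqE, if_true, Finset.mem_union, Finset.mem_sdiff] at hq'
        tauto
      · simp only [pos₁, hqE, if_false, Finset.mem_union, Finset.mem_sdiff] at hq'
        simp only [Finset.mem_sdiff]
        tauto
  have h1 := finrank_mono hlow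
  have h2 := finrank_mono hup
  have h3 := finrank_mono hnew
  omega

end GenericRound

/-! ### Linear codes attaining the minimal cut -/

section LinearCode

open Submodule Module

/-- A functional in the span of a finite family is evaluated by a linear map of the values of the family. -/
theorem Module.Dual.exists_linearMap_of_mem_span_range {F W ι : Type*} [Field F] [AddCommGroup W]
    [Module F W] [Fintype ι] {f : ι → Dual F W} {x : Dual F W} (hx : x ∈ span F (Set.range f)) :
    ∃ g : (ι → F) →ₗ[F] F, ∀ w, x w = g (fun i => f i w) := by
  obtain ⟨c, rfl⟩ := (mem_span_range_iff_exists_fun F).1 hx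
  exact ⟨∑ i, c i • LinearMap.proj i, fun w => by simp [LinearMap.sum_apply]⟩

/-- One round of generic linear repair of a system whose stored symbols are the functionals `vec`
of the file. -/
theorem exists_linear_round {F W : Type} [Field F] [Fintype F] [AddCommGroup W] [Module F W]
    [FiniteDimensional F W] {n r a a₁ : ℕ} (b : ℕ)
    (hq : 2 ^ (n * a) * (2 ^ (n * (a + b)) * 2 ^ (n * (a + b))) < Fintype.card F)
    (vec : Fin n × Fin a → Dual F W) (e : RepairRound n r (Fin a₁ ↪ Fin a)) :
    ∃ (snd : {j : Fin n // j ∉ e.failed} → (Fin a → F) →ₗ[F] (Fin b → F))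
      (rep : {i : Fin n // i ∈ e.failed} →
        ((Fin a₁ → F) × ({j : Fin n // j ∉ e.failed} → Fin b → F)) →ₗ[F] (Fin a → F))
      (vec' : Fin n × Fin a → Dual F W),
      (∀ i, i ∉ e.failed → ∀ c, vec' (i, c) = vec (i, c)) ∧
      (∀ i w c, vec' (i.1, c) w = rep i (fun x => vec (i.1, e.loss i x) w,
        fun j => snd j (fun c => vec (j.1, c) w)) c) ∧
      ∀ (X Y : Finset (Fin n)) (pos : Fin n → Finset (Fin a)), Disjoint X Y →
        (∀ i ∈ Y, (pos i).card = a₁) →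
        (finrank F (span F (vec '' demandedSymbols (X \ e.failed) (Y \ e.failed) pos)) +
            (a * (X ∩ e.failed).card + a₁ * (Y ∩ e.failed).card) ≤
          finrank F (span F (vec' '' demandedSymbols X Y pos))) ∨
        ∃ (R C : Finset (Fin n)) (pos₁ : Fin n → Finset (Fin a)),
          R ⊆ (X ∪ Y) ∩ e.failed ∧ C ⊆ (X ∪ e.failed)ᶜ ∧
          (∀ i ∈ ((Y \ e.failed) \ C) ∪ R, (pos₁ i).card = a₁) ∧
          finrank F (span F (vec '' demandedSymbols ((X \ e.failed) ∪ C)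
              (((Y \ e.failed) \ C) ∪ R) pos₁)) +
              (a * ((X ∩ e.failed) \ R).card + a₁ * ((Y ∩ e.failed) \ R).card) +
              b * ((X ∪ e.failed ∪ C)ᶜ).card ≤
            finrank F (span F (vec' '' demandedSymbols X Y pos)) := by
  classical
  let surv : Fin n → Finset (Fin a) := fun i =>
    if h : i ∈ e.failed then Finset.univ.map (e.loss ⟨i, h⟩) else ∅
  obtain ⟨μ, ν, hμ, hν, hgen⟩ := exists_generic_round (a₁ := a₁) b hq vec e.failed surv
    (fun i hi => by simp [surv, hi])
  have hsend : ∀ p : Fin n × Fin b, ∃ g : (Fin a → F) →ₗ[F] F, ∀ w,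
      μ p w = g (fun c => vec (p.1, c) w) := by
    intro p
    refine Dual.exists_linearMap_of_mem_span_range (f := fun c => vec (p.1, c))
      (span_mono ?_ (hμ p))
    rintro _ ⟨q, hq, rfl⟩
    exact ⟨q.2, by rw [← show q.1 = p.1 from hq]⟩
  choose g hg using hsend
  have hrep : ∀ (i : {i // i ∈ e.failed}) (c : Fin a), ∃ (g₁ : (Fin a₁ → F) →ₗ[F] F)
      (g₂ : ({j // j ∉ e.failed} × Fin b → F) →ₗ[F] F), ∀ w,
      ν (i.1, c) w = g₁ (fun x => vec (i.1, e.loss i x) w) + g₂ (fun q => μ (q.1.1, q.2) w) := by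
    intro i c
    obtain ⟨x, hx, y, hy, hxy⟩ := mem_sup.1 (hν (i.1, c))
    obtain ⟨g₁, h₁⟩ := Dual.exists_linearMap_of_mem_span_range
      (f := fun x => vec (i.1, e.loss i x)) (span_mono (by
        rintro _ ⟨q, ⟨hq1, hq2⟩, rfl⟩
        simp only [surv, i.2, dite_true, Finset.mem_map, Finset.mem_univ, true_and] at hq2
        obtain ⟨z, hz⟩ := hq2
        exact ⟨z, by simp only [hz, ← show q.1 = i.1 from hq1]⟩) hx)
    obtain ⟨g₂, h₂⟩ := Dual.exists_linearMap_of_mem_span_range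
      (f := fun q : {j // j ∉ e.failed} × Fin b => μ (q.1.1, q.2)) (span_mono (by
        rintro _ ⟨q, hq, rfl⟩
        exact ⟨(⟨q.1, hq⟩, q.2), rfl⟩) hy)
    exact ⟨g₁, g₂, fun w => by rw [← hxy, LinearMap.add_apply, h₁, h₂]⟩
  choose g₁ g₂ hg₁₂ using hrep
  refine ⟨fun j => LinearMap.pi fun y => g (j.1, y),
    fun i => LinearMap.pi fun c => (g₁ i c).comp (LinearMap.fst F _ _) +
      ((g₂ i c).comp (LinearEquiv.curry F F _ _).symm.toLinearMap).comp (LinearMap.snd F _ _),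
    fun p => if p.1 ∈ e.failed then ν p else vec p, ?_, ?_, hgen⟩
  · intro i hi c
    simp [hi]
  · intro i w c
    have : (fun q : {j // j ∉ e.failed} × Fin b => μ (q.1.1, q.2) w) =
        (LinearEquiv.curry F F _ _).symm (fun j y => g (j.1, y) (fun c => vec (j.1, c) w)) := by
      funext q
      simp [hg, Function.uncurry]
    simp only [i.2, if_true, hg₁₂, this]
    rfl

/-- Linear codes achieve the minimal cut. -/
theorem RepairCode.exists_isLinear_recovers {n k r T m a a₁ b : ℕ}
    (hcut : ∀ h : List (Finset (Fin n)), (∀ E ∈ h, E.card = r) → h.length ≤ T →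
      ∀ K : Finset (Fin n), K.card = k → ∀ na ns nb, IsCut h K ∅ na ns nb →
        m ≤ na * a + ns * a₁ + nb * b) :
    ∃ (F : Type) (_ : Field F) (_ : Fintype F)
      (c : RepairCode n r (Fin m → F) (Fin a → F) (Fin a₁ → F) (Fin b → F) (Fin a₁ ↪ Fin a)),
      c.IsLinear F ∧ c.Recovers (fun l x => x ∘ l) k T := by
  classical
  obtain ⟨p, hp, hprime⟩ := Nat.exists_infinite_primes
    (2 ^ (n * a) * (2 ^ (n * (a + b)) * 2 ^ (n * (a + b))) + 1)
  have : Fact p.Prime := ⟨hprime⟩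
  let F := ZMod p
  -- The field size does not depend on `T`: each round has to be generic only with respect to the
  -- vectors present at its start.
  have hq : 2 ^ (n * a) * (2 ^ (n * (a + b)) * 2 ^ (n * (a + b))) < Fintype.card F := by
    rw [ZMod.card]; exact hp
  choose snd rep vec' hkeep hnew htrace using fun vec e =>
    exists_linear_round (r := r) (a₁ := a₁) (W := Fin m → F) b hq vec e
  obtain ⟨vec₀, -, hvec₀⟩ := Submodule.exists_generic_vectors (F := F)
    (fun _ : Unit => (⊥ : Submodule F (Dual F (Fin m → F))))
    (fun _ : Fin n × Fin a => (⊤ : Submodule F (Dual F (Fin m → F)))) (by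
      refine lt_of_le_of_lt ?_ hq
      have h1 : 2 ^ (n * a) ≤ 2 ^ (n * (a + b)) :=
        Nat.pow_le_pow_right (by norm_num) (Nat.mul_le_mul_left n (by omega))
      have h2 : 1 ≤ 2 ^ (n * a) := Nat.one_le_two_pow
      simp only [Fintype.card_unit, Fintype.card_prod, Fintype.card_fin]
      gcongr)
  let st : List (RepairRound n r (Fin a₁ ↪ Fin a)) → Fin n × Fin a → Dual F (Fin m → F) :=
    fun h => h.rec vec₀ (fun e _ v => vec' v e)
  let c : RepairCode n r (Fin m → F) (Fin a → F) (Fin a₁ → F) (Fin b → F) (Fin a₁ ↪ Fin a) :=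
    { encode := fun i w x => vec₀ (i, x) w
      send := fun h e j => snd (st h) e j
      repair := fun h e i s t => rep (st h) e i (s, t) }
  have hcontent : ∀ w h i, c.content (fun l x => x ∘ l) w h i = fun x => st h (i, x) w := by
    intro w h
    induction h with
    | nil => intro i; rfl
    | cons e h ih =>
      intro i
      by_cases hi : i ∈ e.failed
      · funext x
        simp only [RepairCode.content, hi, dite_true, ih]
        exact (hnew (st h) e ⟨i, hi⟩ w x).symm
      · simp only [RepairCode.content, hi, dite_false, ih]
        funext x
        exact congrArg (fun f => f w) (hkeep (st h) e i hi x).symm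
  have hrank : ∀ (h : List (RepairRound n r (Fin a₁ ↪ Fin a))) (X Y : Finset (Fin n))
      (pos : Fin n → Finset (Fin a)), Disjoint X Y → (∀ i ∈ Y, (pos i).card = a₁) →
      ∃ na ns nb, IsCut (h.map RepairRound.failed) X Y na ns nb ∧
        min m (na * a + ns * a₁ + nb * b) ≤
          finrank F (span F (st h '' demandedSymbols X Y pos)) := by
    intro h
    induction h with
    | nil =>
      intro X Y pos hd hpos
      refine ⟨_, _, _, IsCut.nil X Y, ?_⟩
      obtain ⟨D₂, -, hle⟩ := hvec₀ () (demandedSymbols X Y pos)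
      rw [bot_sup_eq, bot_sup_eq] at hle
      change _ ≤ finrank F (span F (vec₀ '' demandedSymbols X Y pos))
      -- Every initial symbol ranges over the whole dual space, so a nonempty `D₂` forces full rank
      -- `m`.
      rcases D₂.eq_empty_or_nonempty with rfl | hne
      · rw [Finset.sdiff_empty, card_demandedSymbols hd hpos] at hle
        refine (min_le_right _ _).trans (le_trans ?_ hle)
        rw [zero_mul, mul_comm a, mul_comm a₁]
        omega
      · rw [Finset.sup_const hne, finrank_top, Subspace.dual_finrank_eq,
          Module.finrank_fin_fun] at hle
        exact (min_le_left _ _).trans (by omega)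
    | cons e h ih =>
      intro X Y pos hd hpos
      rcases htrace (st h) e X Y pos hd hpos with hle | ⟨R, C, pos₁, hR, hC, hpos₁, hle⟩
      · obtain ⟨na, ns, nb, cut, hmin⟩ := ih (X \ e.failed) (Y \ e.failed) pos
          (hd.mono Finset.sdiff_subset Finset.sdiff_subset)
          (fun i hi => hpos i (Finset.mem_sdiff.1 hi).1)
        refine ⟨_, _, _, IsCut.pay e.failed _ X Y na ns nb cut, le_trans ?_ hle⟩
        rw [add_mul, add_mul, mul_comm a, mul_comm a₁]
        omega
      · have hd' : Disjoint ((X \ e.failed) ∪ C) (((Y \ e.failed) \ C) ∪ R) := by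
          rw [Finset.disjoint_left]
          intro x hx hx'
          have h1 : x ∈ X → x ∉ Y := fun hx => Finset.disjoint_left.1 hd hx
          have hR' := @hR x
          have hC' := @hC x
          simp only [Finset.mem_union, Finset.mem_sdiff, Finset.mem_inter,
            Finset.mem_compl] at *
          tauto
        obtain ⟨na, ns, nb, cut, hmin⟩ := ih _ _ pos₁ hd' hpos₁
        refine ⟨_, _, _, IsCut.replace e.failed _ X Y R C na ns nb hR hC cut, le_trans ?_ hle⟩
        rw [add_mul, add_mul, add_mul, mul_comm a, mul_comm a₁, mul_comm b]
        omega
  refine ⟨F, inferInstance, inferInstance, c, ⟨fun i => ?_, fun h e j => ?_, fun h e i => ?_⟩, ?_⟩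
  · exact (LinearMap.pi fun x => vec₀ (i, x)).isLinear
  · exact (snd (st h) e j).isLinear
  · exact (rep (st h) e i).isLinear
  intro h hT K hK
  let pos₀ : Fin n → Finset (Fin a) := fun _ => ∅
  obtain ⟨na, ns, nb, cut, hmin⟩ := hrank h K ∅ pos₀ (by simp) (by simp)
  have hm := hcut _ (by
    intro E hE
    obtain ⟨e, -, rfl⟩ := List.mem_map.1 hE
    exact e.card_failed) (by simpa using hT) K hK na ns nb cut
  rw [min_eq_left hm] at hmin
  have htop : span F (st h '' demandedSymbols K ∅ pos₀) = ⊤ := by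
    refine eq_top_of_finrank_eq (le_antisymm (finrank_le _) ?_)
    rwa [Subspace.dual_finrank_eq, Module.finrank_fin_fun]
  have hinj : Function.Injective
      (fun w (i : {i // i ∈ K}) => c.content (fun l x => x ∘ l) w h i.1) := by
    intro w w' hww
    -- The stored functionals of `K` span the dual space, hence separate files.
    have hzero : ∀ f : Dual F (Fin m → F), f (w - w') = 0 := by
      intro f
      have hf : f ∈ span F (st h '' demandedSymbols K ∅ pos₀) := htop ▸ mem_top
      induction hf using span_induction with
      | mem f hf =>
        obtain ⟨q, hq, rfl⟩ := hf
        have hqK : q.1 ∈ K := by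
          simpa using mem_demandedSymbols.1 (Finset.mem_coe.1 hq)
        have := congrFun (congrFun hww ⟨q.1, hqK⟩) q.2
        simp only [hcontent] at this
        rw [map_sub, sub_eq_zero]
        exact this
      | zero => rfl
      | add f g _ _ hf hg => rw [LinearMap.add_apply, hf, hg, add_zero]
      | smul t f _ hf => rw [LinearMap.smul_apply, hf, smul_zero]
    funext i
    exact sub_eq_zero.1 (hzero (LinearMap.proj i))
  exact ⟨Function.invFun _, fun w => Function.leftInverse_invFun hinj w⟩

end LinearCode

/-! ### Feasibility is equivalent to the cut bound -/

/-- Every cut of the system with node capacity `α` has size at least `M`. -/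
def CutBound (n k r : ℕ) (M α γ ρ : ℝ) : Prop :=
  ∀ h : List (Finset (Fin n)), (∀ E ∈ h, E.card = r) → ∀ K : Finset (Fin n), K.card = k →
    ∀ na ns nb, IsCut h K ∅ na ns nb →
      M ≤ na * α + ns * (ρ * α) + nb * (γ / ((n : ℝ) - r))

theorem Feasible.cutBound {n k r : ℕ} {M α γ ρ : ℝ} (hrn : r < n) (hM : 0 < M)
    (hf : Feasible n k r M α γ ρ) : CutBound n k r M α γ ρ := by
  intro h hh K hK na ns nb cut
  by_contra! hlt
  obtain ⟨M', h1, h2⟩ := exists_between (max_lt hM hlt)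
  have := (hf h.length M' h2).le_cut hrn ((le_max_left _ _).trans_lt h1) hh le_rfl hK cut
  exact absurd ((le_max_right _ _).trans_lt h1) (not_lt.2 this)

theorem LinearCodeExists.codeExists {n k r T : ℕ} {M α γ ρ : ℝ} (hρ0 : 0 ≤ ρ) (hρ1 : ρ ≤ 1)
    (hc : LinearCodeExists n k r T M α γ ρ) : CodeExists n k r T M α γ ρ := by
  obtain ⟨F, _, _, m, a, a₁, b, c, L, hL, hm, ha, ha₁, hb, -, hrec⟩ := hc
  have hle : a₁ ≤ a := by
    have : (a₁ : ℝ) ≤ a := ha₁.trans (mul_le_of_le_one_left (Nat.cast_nonneg a) hρ1)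
    exact_mod_cast this
  have hq : 0 < Real.log (Fintype.card F) :=
    Real.log_pos (by exact_mod_cast Fintype.one_lt_card)
  refine ⟨_, _, _, _, _, inferInstance, inferInstance, inferInstance, inferInstance,
    ⟨Fin.castLEEmb hle⟩, _, c, L * Real.log (Fintype.card F), mul_pos hL hq, ?_, ?_, ?_, ?_, hrec⟩
  all_goals
    simp only [Fintype.card_fun, Fintype.card_fin, Nat.cast_pow, Real.log_pow, ← mul_assoc]
    refine mul_le_mul_of_nonneg_right ?_ hq.le
  · exact hm
  · exact ha
  · refine ha₁.trans ?_
    rw [mul_assoc]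
    exact mul_le_mul_of_nonneg_left ha hρ0
  · exact hb

/-- Sizes are scaled by `L` and rounded. A cut over `T` rounds has boundedly many elements
(`IsCut.count_le`), so a large `L` makes the slack `M - M'` outweigh all rounding errors. -/
theorem CutBound.linearlyFeasible {n k r : ℕ} {M α γ ρ : ℝ} (hrn : r < n) (hγ : 0 ≤ γ)
    (hρ0 : 0 ≤ ρ) (hρ1 : ρ ≤ 1) (hα : 0 ≤ α) (hcut : CutBound n k r M α γ ρ) :
    LinearlyFeasible n k r M α γ ρ := by
  intro T M' hM'
  have hpos : (0 : ℝ) < (n : ℝ) - r := sub_pos.2 (by exact_mod_cast hrn)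
  have hβ : 0 ≤ γ / ((n : ℝ) - r) := div_nonneg hγ hpos.le
  set N : ℕ := 3 * n * (T + 1) with hN
  -- Rounding costs at most 1 for `a`, `b` and `m`, and at most 2 for `a₁`, which is rounded after
  -- `a`. A cut thus loses at most `2 * N`, and `m` accounts for the remaining 1.
  set L : ℝ := (2 * N + 1) / (M - M') with hLdef
  have hL : 0 < L := div_pos (by positivity) (sub_pos.2 hM')
  have hLM : L * (M - M') = 2 * N + 1 := div_mul_cancel₀ _ (sub_pos.2 hM').ne'
  set a := ⌊α * L⌋₊ with ha
  set a₁ := ⌊ρ * a⌋₊ with ha₁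
  set b := ⌊γ / ((n : ℝ) - r) * L⌋₊ with hb
  set m := ⌈M' * L⌉₊ with hm
  have ha' := Nat.floor_le (mul_nonneg hα hL.le)
  have hb' := Nat.floor_le (mul_nonneg hβ hL.le)
  have ha₁' := Nat.floor_le (mul_nonneg hρ0 (Nat.cast_nonneg (α := ℝ) a))
  obtain ⟨F, i1, i2, c, hlin, hrec⟩ := RepairCode.exists_isLinear_recovers
    (n := n) (k := k) (r := r) (T := T) (m := m) (a := a) (a₁ := a₁) (b := b) (by
      intro h hh hT K hK na ns nb cut
      rcases le_or_gt M' 0 with h0 | h0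
      · have : m = 0 := Nat.ceil_eq_zero.2 (mul_nonpos_of_nonpos_of_nonneg h0 hL.le)
        omega
      have hcount : ((na : ℝ) + ns + nb) ≤ N := by
        have := cut.count_le
        have h2 : 3 * n * (h.length + 1) ≤ N := Nat.mul_le_mul_left _ (by omega)
        exact_mod_cast this.trans h2
      have h1 := hcut h hh K hK na ns nb cut
      have hm' : (m : ℝ) < M' * L + 1 := Nat.ceil_lt_add_one (mul_nonneg h0.le hL.le)
      have e1 : α * L - 1 ≤ a := (Nat.sub_one_lt_floor _).le
      have e2 : γ / ((n : ℝ) - r) * L - 1 ≤ b := (Nat.sub_one_lt_floor _).le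
      have e3 : ρ * a - 1 ≤ a₁ := (Nat.sub_one_lt_floor _).le
      have e4 : ρ * α * L - 2 ≤ a₁ := by nlinarith
      have f1 := mul_le_mul_of_nonneg_left e1 (Nat.cast_nonneg (α := ℝ) na)
      have f2 := mul_le_mul_of_nonneg_left e4 (Nat.cast_nonneg (α := ℝ) ns)
      have f3 := mul_le_mul_of_nonneg_left e2 (Nat.cast_nonneg (α := ℝ) nb)
      have f4 := mul_le_mul_of_nonneg_right h1 hL.le
      have f5 : (0 : ℝ) ≤ na := Nat.cast_nonneg _
      have f6 : (0 : ℝ) ≤ nb := Nat.cast_nonneg _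
      have : (m : ℝ) ≤ na * a + ns * a₁ + nb * b := by nlinarith
      exact_mod_cast this)
  refine ⟨F, i1, i2, m, a, a₁, b, c, L, hL, Nat.le_ceil _, ha', ha₁', ?_, hlin, hrec⟩
  calc ((n : ℝ) - r) * b ≤ ((n : ℝ) - r) * (γ / ((n : ℝ) - r) * L) :=
        mul_le_mul_of_nonneg_left hb' hpos.le
    _ = γ * L := by field_simp

theorem CutBound.linearCodeExists_of_rat {n k r : ℕ} {M α γ ρ : ℝ} (hrn : r < n) (hM : 0 < M)
    (hγ : 0 ≤ γ) (hρ0 : 0 ≤ ρ) (hα : 0 ≤ α) (hcut : CutBound n k r M α γ ρ)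
    (hαq : ∃ q : ℚ, α = q * M) (hγq : ∃ q : ℚ, γ = q * M) (hρq : ∃ q : ℚ, ρ = q) (T : ℕ) :
    LinearCodeExists n k r T M α γ ρ := by
  obtain ⟨u, rfl⟩ := hαq
  obtain ⟨v, rfl⟩ := hγq
  obtain ⟨w, rfl⟩ := hρq
  have hu : 0 ≤ u := by exact_mod_cast nonneg_of_mul_nonneg_left hα hM
  have hv : 0 ≤ v := by exact_mod_cast nonneg_of_mul_nonneg_left hγ hM
  have hw : 0 ≤ w := by exact_mod_cast hρ0
  have hnat : ∀ q : ℚ, 0 ≤ q → (q : ℝ) * q.den = q.num.toNat := by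
    intro q hq
    have h1 : (q.num.toNat : ℤ) = q.num := Int.toNat_of_nonneg (Rat.num_nonneg.2 hq)
    have h2 : (q * q.den : ℚ) = q.num.toNat := by
      rw [Rat.mul_den_eq_num]; exact_mod_cast h1.symm
    exact_mod_cast h2
  have hu' := hnat u hu
  have hv' := hnat v hv
  have hw' := hnat w hw
  have hpos : (0 : ℝ) < (n : ℝ) - r := sub_pos.2 (by exact_mod_cast hrn)
  have hnr : ((n - r : ℕ) : ℝ) = (n : ℝ) - r := Nat.cast_sub hrn.le
  -- With this common denominator as file dimension no size needs rounding; the factor `n - r` makes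
  -- the message size an integer.
  set D : ℕ := u.den * v.den * w.den * (n - r) with hD
  have hD0 : 0 < D := by
    have := u.den_pos; have := v.den_pos; have := w.den_pos
    have : 0 < n - r := by omega
    positivity
  set a := u.num.toNat * v.den * w.den * (n - r) with ha
  set a₁ := w.num.toNat * u.num.toNat * v.den * (n - r) with ha₁
  set b := v.num.toNat * u.den * w.den with hb
  have hDr : (D : ℝ) = u.den * v.den * w.den * ((n : ℝ) - r) := by rw [hD]; push_cast [hnr]; ring
  have hL : M * (D / M) = D := mul_div_cancel₀ _ hM.ne'
  have ha' : (a : ℝ) = u * M * (D / M) := by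
    rw [mul_assoc, hL, hDr, ha]; push_cast [hnr]; rw [← hu']; ring
  have ha₁' : (a₁ : ℝ) = w * a := by
    rw [ha, ha₁]; push_cast [hnr]; rw [← hw']; ring
  have hb' : (b : ℝ) = v * M / ((n : ℝ) - r) * (D / M) := by
    have : v * M / ((n : ℝ) - r) * (D / M) = v * (M * (D / M)) / ((n : ℝ) - r) := by ring
    rw [this, hL, hDr, hb]; push_cast; rw [← hv']; field_simp
  obtain ⟨F, i1, i2, c, hlin, hrec⟩ := RepairCode.exists_isLinear_recovers
    (n := n) (k := k) (r := r) (T := T) (m := D) (a := a) (a₁ := a₁) (b := b) (by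
      intro h hh _ K hK na ns nb cut
      have h1 := mul_le_mul_of_nonneg_right (hcut h hh K hK na ns nb cut)
        (show 0 ≤ (D : ℝ) / M by positivity)
      have : (D : ℝ) ≤ na * a + ns * a₁ + nb * b := by
        rw [ha₁', hb', ha']
        rw [hL] at h1
        linarith
      exact_mod_cast this)
  refine ⟨F, i1, i2, D, a, a₁, b, c, D / M, by positivity, hL.le, ha'.le, ha₁'.le, ?_, hlin, hrec⟩
  rw [hb']
  apply le_of_eq
  field_simp

theorem CutBound.mono {n k r : ℕ} {M α α' γ ρ : ℝ} (hρ0 : 0 ≤ ρ) (h : α ≤ α')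
    (hcut : CutBound n k r M α γ ρ) : CutBound n k r M α' γ ρ := by
  intro hs hh K hK na ns nb cut
  refine (hcut hs hh K hK na ns nb cut).trans ?_
  gcongr

/-- Each cut cost is continuous in `α` and the inequality is not strict. This is what admits the
threshold itself. -/
theorem cutBound_of_forall_lt {n k r : ℕ} {M α γ ρ : ℝ}
    (hcut : ∀ α', α < α' → CutBound n k r M α' γ ρ) : CutBound n k r M α γ ρ := by
  intro hs hh K hK na ns nb cut
  have hcont : Filter.Tendsto
      (fun x : ℝ => (na : ℝ) * x + ns * (ρ * x) + nb * (γ / ((n : ℝ) - r)))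
      (nhdsWithin α (Set.Ioi α))
      (nhds (na * α + ns * (ρ * α) + nb * (γ / ((n : ℝ) - r)))) :=
    (Continuous.tendsto (by fun_prop) α).mono_left nhdsWithin_le_nhds
  refine ge_of_tendsto hcont ?_
  filter_upwards [self_mem_nhdsWithin] with x hx
  exact hcut x hx hs hh K hK na ns nb cut

/-! ### The potential and the explicit trade-off -/

/-- A family of lines whose minimum is a potential function for `IsCut.potential_le`. -/
noncomputable def potentialLine (n x₀ r A β : ℝ) : ℕ → ℝ → ℝ
  | 0, x => A * x
  | j + 1, x => A * x₀ + β * (j * (n - r - x₀) - r * (j * (j - 1)) / 2) +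
      (x - x₀ - j * r) * (β * (n - r - x₀ - j * r) / r)

theorem potentialLine_one_sub {n x₀ r A β : ℝ} (x : ℝ) :
    potentialLine n x₀ r A β 1 x = A * x - (x - x₀) * (A - β * (n - r - x₀) / r) := by
  simp only [potentialLine, CharP.cast_eq_zero]; ring

/-- Consecutive slopes differ by `β`, and these two lines cross at `x₀ + (j + 1) * r`. -/
theorem potentialLine_succ_succ {n x₀ r A β : ℝ} (hr : r ≠ 0) (j : ℕ) (x : ℝ) :
    potentialLine n x₀ r A β (j + 2) x =
      potentialLine n x₀ r A β (j + 1) x - β * (x - x₀ - (j + 1) * r) := by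
  simp only [potentialLine, Nat.cast_add, Nat.cast_one]; field_simp; ring

/-- With `x₀ = k - i * r`, the potential is linear of slope `A` up to `x₀`; from there to `k` it
interpolates linearly between the points `x₀ + j * r`, gaining from `w` to `w + r` exactly the `(n -
r - w) * β` that `IsCut.potential_le` allows. By `h2` the first of these slopes is at most `A`,
which gives concavity; by `h1` the slope `A` is small enough for batches starting below `x₀`. -/
theorem exists_potential {n k r i : ℕ} {A β : ℝ} (hr : 1 ≤ r) (hkr : k + r ≤ n) (hi : i * r ≤ k)
    (hA : 0 ≤ A) (hβ : 0 ≤ β) (h1 : A * r ≤ β * (n - k + i * r))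
    (h2 : 1 ≤ i → β * (n - r - k + i * r) ≤ A * r) :
    ∃ ψ : ℕ → ℝ, A * (k - i * r) + β * (i * (n - k) + r * (i * (i - 1)) / 2) ≤ ψ k ∧
      (∀ x, ψ x ≤ A * x) ∧ (∀ x y, ψ (x + y) ≤ ψ x + A * y) ∧
      ∀ x w : ℕ, x ≤ w + r → w + r ≤ n → ψ x ≤ ψ w + ((n : ℝ) - r - w) * β := by
  have hr0 : (0 : ℝ) < r := by exact_mod_cast hr
  have hkrR : (k : ℝ) + r ≤ n := by exact_mod_cast hkr
  have hiR : (i : ℝ) * r ≤ k := by exact_mod_cast hi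
  set x₀ : ℝ := k - i * r with hx₀
  set ℓ : ℕ → ℝ → ℝ := potentialLine n x₀ r A β with hℓ
  have hslope : ∀ j ≤ i, ∃ s, 0 ≤ s ∧ s ≤ A ∧ ∀ x y, ℓ j y = ℓ j x + s * (y - x) := by
    intro j hj
    cases j with
    | zero => exact ⟨A, hA, le_rfl, fun x y => by simp only [hℓ, potentialLine]; ring⟩
    | succ j =>
      have hji : (j : ℝ) + 1 ≤ i := by exact_mod_cast hj
      have e1 : (j : ℝ) * r + r ≤ i * r := by nlinarith
      have e2 : (0 : ℝ) ≤ j * r := by positivity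
      refine ⟨β * (n - r - x₀ - j * r) / r, ?_, ?_, fun x y => ?_⟩
      · refine div_nonneg (mul_nonneg hβ ?_) hr0.le
        rw [hx₀]; linarith
      · rw [div_le_iff₀ hr0]
        refine le_trans (mul_le_mul_of_nonneg_left ?_ hβ) (h2 (by omega))
        rw [hx₀]; linarith
      · simp only [hℓ, potentialLine]; ring
  have hne : (Finset.range (i + 1)).Nonempty := ⟨0, by simp⟩
  -- Freezing the argument at `k` keeps `ψ` nondecreasing and gives `z + r ≤ n` for the truncated
  -- value `z` used below.
  set ψ : ℕ → ℝ := fun x => (Finset.range (i + 1)).inf' hne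
    (fun j => ℓ j (min x k : ℕ)) with hψ
  have hψle : ∀ j ≤ i, ∀ x, ψ x ≤ ℓ j (min x k : ℕ) := fun j hj x =>
    Finset.inf'_le (f := fun j => ℓ j (min x k : ℕ)) (Finset.mem_range.2 (by omega))
  have hψeq : ∀ x, ∃ j ≤ i, ψ x = ℓ j (min x k : ℕ) := by
    intro x
    obtain ⟨j, hj, he⟩ := Finset.exists_mem_eq_inf' hne (fun j => ℓ j (min x k : ℕ))
    exact ⟨j, by simpa [Nat.lt_succ_iff] using hj, he⟩
  refine ⟨ψ, ?_, fun x => ?_, fun x y => ?_, fun x w hxw hwn => ?_⟩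
  · have htarget : ℓ i k = A * (k - i * r) + β * (i * (n - k) + r * (i * (i - 1)) / 2) := by
      cases i with
      | zero => simp [hℓ, potentialLine]
      | succ i =>
        simp only [hℓ, potentialLine, hx₀, Nat.cast_add, Nat.cast_one]; field_simp; ring
    rw [← hx₀] at htarget
    rw [← htarget]
    have hdec : ∀ j, j < i → ℓ (j + 1) k ≤ ℓ j k := by
      intro j hj
      cases j with
      | zero =>
        simp only [hℓ]
        rw [zero_add, potentialLine_one_sub]
        have e1 : 0 ≤ (k : ℝ) - x₀ := by rw [hx₀]; nlinarith
        have e2 : 0 ≤ A - β * (n - r - x₀) / r := by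
          rw [sub_nonneg, div_le_iff₀ hr0]
          refine le_trans (le_of_eq ?_) (h2 (by omega))
          rw [hx₀]; ring
        have := mul_nonneg e1 e2
        simp only [potentialLine]; linarith
      | succ j =>
        simp only [hℓ]
        rw [potentialLine_succ_succ hr0.ne']
        have hji : (j : ℝ) + 1 ≤ i := by exact_mod_cast (show j + 1 ≤ i by omega)
        have : 0 ≤ β * (k - x₀ - (j + 1) * r) := mul_nonneg hβ (by rw [hx₀]; nlinarith)
        linarith
    have hall : ∀ d j, j + d = i → ℓ i k ≤ ℓ j k := by
      intro d
      induction d with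
      | zero => intro j hj; simp at hj; rw [hj]
      | succ d ih => intro j hj; exact (ih (j + 1) (by omega)).trans (hdec j (by omega))
    obtain ⟨j, hj, he⟩ := hψeq k
    rw [he, min_self]
    exact hall (i - j) j (by omega)
  · refine (hψle 0 (by omega) x).trans ?_
    simp only [hℓ, potentialLine]
    have : ((min x k : ℕ) : ℝ) ≤ x := by exact_mod_cast min_le_left _ _
    gcongr
  · obtain ⟨j, hj, he⟩ := hψeq x
    obtain ⟨s, hs0, hsA, hs⟩ := hslope j hj
    rw [he]
    refine (hψle j hj (x + y)).trans ?_
    rw [hs (min x k : ℕ) (min (x + y) k : ℕ)]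
    have e1 : ((min (x + y) k : ℕ) : ℝ) ≤ (min x k : ℕ) + y := by
      exact_mod_cast (show min (x + y) k ≤ min x k + y by omega)
    have e2 : ((min x k : ℕ) : ℝ) ≤ (min (x + y) k : ℕ) := by
      exact_mod_cast (show min x k ≤ min (x + y) k by omega)
    have e3 : s * (((min (x + y) k : ℕ) : ℝ) - (min x k : ℕ)) ≤ s * y :=
      mul_le_mul_of_nonneg_left (by linarith) hs0
    have e4 : s * y ≤ A * y := mul_le_mul_of_nonneg_right hsA (Nat.cast_nonneg _)
    linarith
  · have hwnR : (w : ℝ) + r ≤ n := by exact_mod_cast hwn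
    obtain ⟨j, hj, he⟩ := hψeq w
    rcases le_or_gt (min x k) (min w k) with hle | hlt
    · obtain ⟨s, hs0, hsA, hs⟩ := hslope j hj
      have e0 := hψle j hj x
      rw [hs (min w k : ℕ) (min x k : ℕ)] at e0
      have e1 : ((min x k : ℕ) : ℝ) ≤ (min w k : ℕ) := by exact_mod_cast hle
      have e2 := mul_nonneg hs0 (sub_nonneg.2 e1)
      have e3 : 0 ≤ ((n : ℝ) - r - w) * β := mul_nonneg (by linarith) hβ
      rw [he]; linarith
    have hwk : min w k = w := by omega
    rw [hwk] at he
    obtain ⟨z, hz⟩ : ∃ z, min x k = z := ⟨_, rfl⟩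
    rw [hz, hwk] at hlt
    have hψz : ∀ j ≤ i, ψ x ≤ ℓ j z := fun j hj => hz ▸ hψle j hj x
    have hzk : (z : ℝ) ≤ k := by exact_mod_cast (show z ≤ k by omega)
    have hwz : (w : ℝ) ≤ z := by exact_mod_cast hlt.le
    have hzw : (z : ℝ) ≤ w + r := by exact_mod_cast (show z ≤ w + r by omega)
    set t : ℝ := (z - w) / r with ht
    have htr : t * r = z - w := div_mul_cancel₀ _ hr0.ne'
    have ht0 : 0 ≤ t := div_nonneg (by linarith) hr0.le
    have ht1 : t ≤ 1 := by rw [ht, div_le_one hr0]; linarith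
    have hconv : ∀ u v : ℝ, ψ x ≤ u → ψ x ≤ v → ψ x ≤ (1 - t) * u + t * v := by
      intro u v hu hv
      have := mul_le_mul_of_nonneg_left hu (sub_nonneg.2 ht1)
      have := mul_le_mul_of_nonneg_left hv ht0
      linarith
    -- The difference of the two sides is `β * (1 - t) * (n - z - r)`.
    have hfin : t * (β * (n - z)) ≤ ((n : ℝ) - r - w) * β := by
      have : t * (n - z) ≤ (n : ℝ) - r - w := by
        have : 0 ≤ (1 - t) * ((n : ℝ) - z - r) := mul_nonneg (by linarith) (by linarith)
        nlinarith
      nlinarith [mul_le_mul_of_nonneg_left this hβ]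
    -- As `ψ x` lies below all lines at `z`, it lies below their convex combinations. Weight `t` on
    -- the next line produces exactly `β * (n - z)`; for the last line, `z ≤ k` suffices.
    have hsucc : ∀ j, j + 1 ≤ i → ψ x ≤ ℓ (j + 1) w + t * (β * (n - z)) := by
      intro j hj
      have hlin : ℓ (j + 1) z = ℓ (j + 1) w + t * (β * (n - r - x₀ - j * r)) := by
        simp only [hℓ, potentialLine]
        rw [ht]; field_simp; ring
      rcases Nat.lt_or_ge (j + 1) i with hj' | hj'
      · have := hconv _ _ (hψz (j + 1) hj) (hψz (j + 2) hj')
        refine this.trans (le_of_eq ?_)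
        have e := potentialLine_succ_succ (n := n) (x₀ := x₀) (A := A) (β := β) hr0.ne' j z
        rw [← hℓ] at e
        rw [e, hlin]; ring
      · have hji : (i : ℝ) = j + 1 := by exact_mod_cast (le_antisymm hj' hj)
        refine (hψz (j + 1) hj).trans ?_
        rw [hlin]
        have : (n : ℝ) - r - x₀ - j * r ≤ n - z := by rw [hx₀, hji]; linarith
        gcongr
    rw [he]
    suffices hsuff : ψ x ≤ ℓ j w + t * (β * (n - z)) by linarith
    cases j with
    | succ j => exact hsucc j hj
    | zero =>
      have e0 : ∀ y, ℓ 0 y = A * y := fun y => by simp only [hℓ, potentialLine]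
      have e1 : ∀ y, ℓ 1 y = A * y - (y - x₀) * (A - β * (n - r - x₀) / r) :=
        fun y => potentialLine_one_sub y
      rcases Nat.eq_zero_or_pos i with hi0 | hi0
      · have e2 := hψz 0 (by omega)
        rw [e0] at e2
        rw [hi0] at h1
        simp only [CharP.cast_eq_zero, zero_mul, add_zero] at h1
        rw [e0]
        have e3 : A * r * t ≤ β * (n - k) * t := mul_le_mul_of_nonneg_right h1 ht0
        have e4 : t * (β * (n - k)) ≤ t * (β * (n - z)) := by gcongr
        nlinarith
      · have hsl : 0 ≤ A - β * (n - r - x₀) / r := by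
          rw [sub_nonneg, div_le_iff₀ hr0]
          refine le_trans (le_of_eq ?_) (h2 hi0)
          rw [hx₀]; ring
        rcases le_or_gt x₀ w with hw0 | hw0
        · refine (hsucc 0 hi0).trans ?_
          rw [zero_add, e1, e0]
          have := mul_nonneg (sub_nonneg.2 hw0) hsl
          linarith
        · refine (hconv _ _ (hψz 0 (by omega)) (hψz 1 hi0)).trans ?_
          rw [e0, e1, e0]
          have e5 : A * r ≤ β * (n - x₀) := h1.trans (le_of_eq (by rw [hx₀]; ring))
          have e6 : A ≤ β * (n - x₀) / r := by rwa [le_div_iff₀ hr0]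
          have e7 : A * (r - (z - x₀)) ≤ β * (n - x₀) / r * (r - (z - x₀)) :=
            mul_le_mul_of_nonneg_right e6 (by linarith)
          have e8 : A * (r - (z - x₀)) + (z - x₀) * (β * (n - r - x₀) / r) ≤ β * (n - z) := by
            refine (add_le_add_left e7 _).trans (le_of_eq ?_)
            field_simp; ring
          have e9 := mul_le_mul_of_nonneg_left e8 ht0
          have e10 : A * z = A * w + A * (t * r) := by rw [htr]; ring
          rw [e10] at *
          linarith

/-- The piece of the trade-off curve between two consecutive breakpoints. -/
theorem isLeast_cutBound {n k r i : ℕ} {M γ ρ : ℝ} (hr : 1 ≤ r) (hM : 0 < M) (hγ : 0 ≤ γ)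
    (hρ0 : 0 ≤ ρ) (hρ1 : ρ ≤ 1) (hkr : k + r ≤ n) (hi : i * r + r ≤ k)
    (hlow : repairF n k r M ρ i ≤ γ) (hupp : 1 ≤ i → γ ≤ repairF n k r M ρ (i - 1)) :
    IsLeast {α : ℝ | 0 ≤ α ∧ CutBound n k r M α γ ρ}
      ((M - repairG n k r i * γ) / ((k : ℝ) - i * r * (1 - ρ))) := by
  have hr0 : (0 : ℝ) < r := by exact_mod_cast hr
  have hkrR : (k : ℝ) + r ≤ n := by exact_mod_cast hkr
  have hiR : (i : ℝ) * r + r ≤ k := by exact_mod_cast hi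
  have hi0 : (0 : ℝ) ≤ i := Nat.cast_nonneg _
  have hir0 : (0 : ℝ) ≤ i * r := by positivity
  have hk0 : (0 : ℝ) < k := by linarith
  have hnr : (0 : ℝ) < (n : ℝ) - r := by linarith
  have hA1 : 0 ≤ 1 - ρ := by linarith
  set β : ℝ := γ / ((n : ℝ) - r) with hβ
  have hβ0 : 0 ≤ β := div_nonneg hγ hnr.le
  have hγβ : γ = β * ((n : ℝ) - r) := (div_mul_cancel₀ _ hnr.ne').symm
  set c : ℝ := (k : ℝ) - i * r * (1 - ρ) with hc
  have hc0 : 0 < c := by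
    have : (i : ℝ) * r * (1 - ρ) ≤ i * r := mul_le_of_le_one_right hir0 (by linarith)
    linarith
  have hG : repairG n k r i * γ = β * (i * (n - k) + r * (i * (i - 1)) / 2) := by
    rw [repairG, hγβ]; field_simp; ring
  have hden : ∀ j : ℕ, (j : ℝ) * r + r ≤ k →
      0 < (2 * (k : ℝ) - r * ((j : ℝ) + 1) * (1 - ρ)) * j + 2 * (k : ℝ) / r * ((n : ℝ) - k) := by
    intro j hj
    have e1 : (r : ℝ) * ((j : ℝ) + 1) * (1 - ρ) ≤ r * ((j : ℝ) + 1) :=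
      mul_le_of_le_one_right (by positivity) (by linarith)
    have e2 : 0 ≤ (2 * (k : ℝ) - r * ((j : ℝ) + 1) * (1 - ρ)) * j :=
      mul_nonneg (by linarith) (Nat.cast_nonneg _)
    have e3 : 0 < 2 * (k : ℝ) / r * ((n : ℝ) - k) := mul_pos (by positivity) (by linarith)
    linarith
  set α : ℝ := (M - repairG n k r i * γ) / c with hα
  have hαc : α * c = M - β * (i * (n - k) + r * (i * (i - 1)) / 2) := by
    rw [hα, div_mul_cancel₀ _ hc0.ne', hG]
  -- Multiplied by `c` and with `α * c` substituted, the slope conditions `h1` and `h2` become `f(i)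
  -- ≤ γ` and `γ ≤ f(i - 1)` with denominators cleared.
  have h1 : (1 - ρ) * α * r ≤ β * (n - k + i * r) := by
    rw [repairF, div_le_iff₀ (hden i hiR), hγβ] at hlow
    have e1 : M * (1 - ρ) * r ≤ β * (k * i * r - r ^ 2 * i * (i + 1) * (1 - ρ) / 2
        + k * (n - k)) := by
      refine le_of_mul_le_mul_left ?_ hnr
      have e2 := mul_le_mul_of_nonneg_right hlow (show 0 ≤ (r : ℝ) / 2 by positivity)
      refine le_trans (le_of_eq (by ring)) (e2.trans (le_of_eq ?_))
      field_simp
    refine le_of_mul_le_mul_right ?_ hc0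
    have e3 : (1 - ρ) * α * r * c = (1 - ρ) * r * (α * c) := by ring
    rw [e3, hαc]
    refine le_trans (le_of_eq ?_) (sub_le_sub_right e1
      ((1 - ρ) * r * (β * (i * (n - k) + r * (i * (i - 1)) / 2)))) |>.trans (le_of_eq ?_)
    · ring
    · rw [hc]; ring
  have h2 : 1 ≤ i → β * (n - r - k + i * r) ≤ (1 - ρ) * α * r := by
    intro hi1
    have hcast : ((i - 1 : ℕ) : ℝ) = i - 1 := by rw [Nat.cast_sub hi1, Nat.cast_one]
    have hupp := hupp hi1
    rw [repairF, le_div_iff₀ (hden (i - 1) (by rw [hcast]; linarith)), hcast, hγβ] at hupp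
    have e1 : β * (k * (i - 1) * r - r ^ 2 * i * (i - 1) * (1 - ρ) / 2
        + k * (n - k)) ≤ M * (1 - ρ) * r := by
      refine le_of_mul_le_mul_left ?_ hnr
      have e2 := mul_le_mul_of_nonneg_right hupp (show 0 ≤ (r : ℝ) / 2 by positivity)
      refine le_trans (le_of_eq ?_) (e2.trans (le_of_eq (by ring)))
      field_simp; ring
    refine le_of_mul_le_mul_right ?_ hc0
    have e3 : (1 - ρ) * α * r * c = (1 - ρ) * r * (α * c) := by ring
    rw [e3, hαc]
    refine le_trans (le_of_eq ?_) (sub_le_sub_right e1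
      ((1 - ρ) * r * (β * (i * (n - k) + r * (i * (i - 1)) / 2)))) |>.trans (le_of_eq ?_)
    · rw [hc]; ring
    · ring
  have hα0 : 0 ≤ α := by
    rcases Nat.eq_zero_or_pos i with hi' | hi'
    · refine div_nonneg ?_ hc0.le
      rw [hG, hi']; simp [hM.le]
    -- For `ρ = 1` the condition `h2` does not bound `α`, but then `f(i - 1) = 0` forces `γ = 0`.
    · rcases hA1.eq_or_lt with hρ | hρ
      · have hupp := hupp hi'
        rw [repairF, ← hρ] at hupp
        have : γ = 0 := le_antisymm (by simpa using hupp) hγ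
        refine div_nonneg ?_ hc0.le
        rw [this, mul_zero, sub_zero]; exact hM.le
      · have e1 := h2 hi'
        have e2 : 0 ≤ β * (n - r - k + i * r) := mul_nonneg hβ0 (by linarith)
        have e3 : 0 ≤ α * ((1 - ρ) * r) := by linarith
        exact nonneg_of_mul_nonneg_left e3 (mul_pos hρ hr0)
  refine ⟨⟨hα0, fun h hh K hK na ns nb cut => ?_⟩, fun α' hα' => ?_⟩
  · obtain ⟨ψ, hψk, hψ0, hψstep, hψbatch⟩ := exists_potential (i := i) hr hkr
      (by omega) (mul_nonneg hA1 hα0) hβ0 h1 h2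
    have e : (1 - ρ) * α = α - ρ * α := by ring
    rw [e] at hψ0 hψstep
    have := cut.potential_le (r := r) (σ := ρ * α) (α := α) (β := β)
      (mul_le_of_le_one_left hα0 hρ1) (mul_nonneg hρ0 hα0) hψ0 hψstep hψbatch hh (by simp)
    rw [hK, Finset.card_empty] at this
    refine le_trans ?_ this
    have e2 : M = α * c + β * (i * (n - k) + r * (i * (i - 1)) / 2) := by rw [hαc]; ring
    rw [e2, hc]
    simp only [CharP.cast_eq_zero, add_zero]
    linarith
  · rw [hα, div_le_iff₀ hc0, hG]
    obtain ⟨K, -, hK⟩ := Finset.exists_subset_card_eq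
      (show k ≤ (Finset.univ : Finset (Fin n)).card by simp; omega)
    obtain ⟨h, nb, hh, cut, hnb⟩ := IsCut.exists_batches (r := r) i K ∅ (by simp)
      (by rw [hK]; omega)
    have := hα'.2 h hh K hK _ _ _ cut
    rw [hnb, hK, Nat.cast_sub (by omega)] at this
    simp only [Finset.card_empty, zero_add, Nat.cast_mul] at this
    rw [hc]
    rw [← hβ] at this
    linarith

/-! ### The threshold -/

theorem theorem1 (n k r : ℕ) (hk : 1 ≤ k) (hkn : k ≤ n) (hr : 1 ≤ r) (hrn : r < n)
    (M γ ρ : ℝ) (hM : 0 < M) (hγ : 0 ≤ γ) (hρ0 : 0 ≤ ρ) (hρ1 : ρ ≤ 1) :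
    ∃ αs : EReal,
      (∀ α : ℝ, 0 ≤ α → αs ≤ (α : EReal) →
        Feasible n k r M α γ ρ ∧ LinearlyFeasible n k r M α γ ρ ∧
        ((∃ q : ℚ, α = q * M) → (∃ q : ℚ, γ = q * M) → (∃ q : ℚ, ρ = q) →
          ∀ T : ℕ, LinearCodeExists n k r T M α γ ρ)) ∧
      (∀ α : ℝ, 0 ≤ α → (α : EReal) < αs → ¬ Feasible n k r M α γ ρ) ∧
      (r ∣ k → k + r ≤ n →
        (repairF n k r M ρ 0 ≤ γ → αs = ((M / k : ℝ) : EReal)) ∧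
        (∀ i : ℕ, 1 ≤ i → i ≤ k / r - 1 →
          repairF n k r M ρ i ≤ γ → γ ≤ repairF n k r M ρ (i - 1) →
          αs = (((M - repairG n k r i * γ) / ((k : ℝ) - i * r * (1 - ρ)) : ℝ) : EReal))) := by
  set S : Set ℝ := {α : ℝ | 0 ≤ α ∧ CutBound n k r M α γ ρ} with hS
  have hleast : ∀ a : ℝ, IsLeast S a → sInf ((fun x : ℝ => (x : EReal)) '' S) = a := by
    intro a ha
    have hl : IsLeast ((fun x : ℝ => (x : EReal)) '' S) (a : EReal) := by
      refine ⟨⟨a, ha.1, rfl⟩, ?_⟩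
      rintro _ ⟨x, hx, rfl⟩
      exact EReal.coe_le_coe_iff.2 (ha.2 hx)
    exact hl.isGLB.sInf_eq
  -- The infimum is taken in `EReal`, so that it is `⊤` when no capacity satisfies the cut bound,
  -- for instance when `γ = ρ = 0`.
  refine ⟨sInf ((fun x : ℝ => (x : EReal)) '' S), fun α hα hle => ?_, fun α hα hlt hf => ?_,
    fun hdvd hkr => ⟨fun hlow => ?_, fun i hi hik hlow hupp => ?_⟩⟩
  · have hcut : CutBound n k r M α γ ρ := by
      refine cutBound_of_forall_lt fun α' hα' => ?_
      obtain ⟨_, ⟨x, hx, rfl⟩, hxα⟩ := sInf_lt_iff.1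
        (hle.trans_lt (EReal.coe_lt_coe_iff.2 hα'))
      exact hx.2.mono hρ0 (EReal.coe_lt_coe_iff.1 hxα).le
    have hlin := hcut.linearlyFeasible hrn hγ hρ0 hρ1 hα
    exact ⟨fun T M' hM' => (hlin T M' hM').codeExists hρ0 hρ1, hlin,
      hcut.linearCodeExists_of_rat hrn hM hγ hρ0 hα⟩
  · have hα' : sInf ((fun x : ℝ => (x : EReal)) '' S) ≤ (α : EReal) :=
      sInf_le (Set.mem_image_of_mem _ (show α ∈ S from ⟨hα, hf.cutBound hrn hM⟩))
    exact absurd hα' (not_le.2 hlt)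
  · have hrk : r ≤ k := Nat.le_of_dvd hk hdvd
    have := isLeast_cutBound (i := 0) hr hM hγ hρ0 hρ1 hkr (by simpa using hrk) hlow (by simp)
    rw [hleast _ this]
    simp [repairG]
  · refine hleast _ (isLeast_cutBound hr hM hγ hρ0 hρ1 hkr ?_ hlow fun _ => hupp)
    have h1 : 1 ≤ k / r := Nat.div_pos (Nat.le_of_dvd hk hdvd) hr
    calc i * r + r = (i + 1) * r := by ring
      _ ≤ k / r * r := Nat.mul_le_mul_right r (by omega)
      _ = k := Nat.div_mul_cancel hdvd
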